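/- Let $d\ge 3$ and let $V:\mathbb R^d\to[0,\infty)$ be locally integrable, not almost everywhere zero, and in the reverse Hölder class $RH_s(\mathbb R^d)$ for some $s\in[d/2,\infty]$; that is, for some constant $C>0$, $\big(\frac1{|B|}\int_B V^s\big)^{1/s}\le C\,\frac1{|B|}\int_B V$ for all balls $B$ (with the essential supremum of $V$ over $B$ on the left if $s=\infty$). Let $$\rho(x)=\sup\Big\{r>0:\ \frac1{r^{d-2}}\int_{B(x,r)}V(y)\,dy\le 1\Big\}.$$ Let $Q(x_0,r)$ denote the cube with centre $x_0$, side length $r$ and sides parallel to the axes. For $\theta>0$ let $\mathrm{BLO}_{\rho,\theta}$ be the set of $f\in L^1_{\rm loc}(\mathbb R^d)$ with $$\|f\|_{\mathrm{BLO}_{\rho,\theta}}=\sup_{Q=Q(x_0,r)}\Big(1+\frac r{\rho(x_0)}\Big)^{-\theta}\frac1{|Q|}\int_Q\Big[f(x)-\operatorname*{ess\,inf}_{y\in Q}f(y)\Big]dx<\infty .$$ For $1\le p<q<\infty$ and $\theta>0$ let $A^{\rho,\theta}_{p,q}$ be the set of nonnegative locally integrable functions $\omega$, not almost everywhere zero,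 with $$[\omega]_{A^{\rho,\theta}_{p,q}}=\sup_{B=B(x_0,r)}\Big(1+\frac r{\rho(x_0)}\Big)^{-\theta}\Big(\frac1{|B|}\int_B\omega^q\Big)^{1/q}\Big(\frac1{|B|}\int_B\omega^{-p'}\Big)^{1/p'}<\infty,\qquad p'=\frac p{p-1},$$ where for $p=1$ the last factor is replaced by $(\operatorname{ess\,inf}_B\omega)^{-1}$. Write $\omega^q(E)=\int_E\omega^q$. There are constants $C_0\ge1$ and $N_0>0$ such that for all $x,y\in\mathbb R^d$ $$\frac1{C_0}\Big(1+\frac{|x-y|}{\rho(x)}\Big)^{-N_0}\le\frac{\rho(y)}{\rho(x)}\le C_0\Big(1+\frac{|x-y|}{\rho(x)}\Big)^{\frac{N_0}{N_0+1}}.\tag{a}$$ Fix any such $C_0,N_0$, and let $1\le p<q<\infty$ and $0<\theta_2<\infty$. For every $M<\infty$ there are $\delta\in(0,1)$, $\eta>1$ and $K>0$ such that every $\omega\in A^{\rho,\theta_2}_{p,q}$ with $[\omega]_{A^{\rho,\theta_2}_{p,q}}\le M$ satisfies $$\omega^q(E)\le K\Big(\frac{|E|}{|Q|}\Big)^{\delta}\Big(1+\frac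 r{\rho(x_0)}\Big)^{\eta}\omega^q(Q)\quad\text{for all cubes }Q=Q(x_0,r)\text{ and all measurable }E\subset Q.\tag{b}$$ Moreover, the following statements are true. (1) Let $\delta\in(0,1)$, $\eta>1$, $K>0$ and $0<\theta_1<\infty$. There is a constant $C>0$, depending only on $d,V,C_0,N_0,p,q,\theta_1,\theta_2,\delta,\eta,K$, such that for every $\omega\in A^{\rho,\theta_2}_{p,q}$ that satisfies (b) with $\delta,\eta,K$, every $f\in\mathrm{BLO}_{\rho,\theta_1}$ and every cube $Q=Q(x_0,r)$, $$\Big(\frac1{\omega^q(Q)}\int_Q\Big[f(x)-\operatorname*{ess\,inf}_{y\in Q}f(y)\Big]^q\omega(x)^q\,dx\Big)^{1/q}\le C\,[\omega]_{A^{\rho,\theta_2}_{p,q}}\Big(1+\frac r{\rho(x_0)}\Big)^{(N_0+1)\theta_1+\eta/q}\|f\|_{\mathrm{BLO}_{\rho,\theta_1}} .$$ (2) Conversely, for every $M<\infty$ there is a constant $c>0$, depending only on $d,V,C_0,N_0,p,q,\theta_2,M$, such that the following holds for every $\omega\in A^{\rho,\theta_2}_{p,q}$ with $[\omega]_{A^{\rho,\theta_2}_{p,q}}\le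 M$ and every measurable $f:\mathbb R^d\to\mathbb R$. If for some $\theta_1>0$ and $C>0$ $$\Big(\frac1{\omega^q(Q)}\int_Q\Big[f(x)-\operatorname*{ess\,inf}_{y\in Q}f(y)\Big]^q\omega(x)^q\,dx\Big)^{1/q}\le C\,[\omega]_{A^{\rho,\theta_2}_{p,q}}\Big(1+\frac r{\rho(x_0)}\Big)^{\theta_1-\theta_2}$$ for every cube $Q=Q(x_0,r)$, then $f\in\mathrm{BLO}_{\rho,\theta_1}$ and $\|f\|_{\mathrm{BLO}_{\rho,\theta_1}}\le c\,C\,[\omega]_{A^{\rho,\theta_2}_{p,q}}$. -/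

import Mathlib

open MeasureTheory
open scoped ENNReal NNReal

noncomputable section

namespace Schrodinger

/-- The open cube centred at `x₀` with side length `r` and sides parallel to the axes. -/
def cube {d : ℕ} (x₀ : EuclideanSpace ℝ (Fin d)) (r : ℝ) : Set (EuclideanSpace ℝ (Fin d)) :=
  {x | ∀ i, |x i - x₀ i| < r / 2}

/-- The mean `|S|⁻¹ ∫_S g` of a `[0, ∞]`-valued function. -/
def mean {d : ℕ} (S : Set (EuclideanSpace ℝ (Fin d)))
    (g : EuclideanSpace ℝ (Fin d) → ℝ≥0∞) : ℝ≥0∞ :=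
  (volume S)⁻¹ * ∫⁻ x in S, g x

/-- The reverse Hölder class `RH_s`, for an exponent `s` in `(1, ∞]`: over every ball, the
normalized `L^s` norm (an essential supremum if `s = ∞`) is at most `C` times the mean. -/
def ReverseHolder {d : ℕ} (s : ℝ≥0∞) (V : EuclideanSpace ℝ (Fin d) → ℝ) : Prop :=
  ∃ C : ℝ, 0 < C ∧ ∀ (x : EuclideanSpace ℝ (Fin d)) (r : ℝ), 0 < r →
    eLpNorm V s ((volume (Metric.ball x r))⁻¹ • volume.restrict (Metric.ball x r)) ≤
      ENNReal.ofReal C * mean (Metric.ball x r) (fun y => ENNReal.ofReal (V y))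

/-- The critical radius function
`ρ(x) = sup {r > 0 : r^{-(d-2)} ∫_{B(x,r)} V ≤ 1}`. -/
def criticalRadius {d : ℕ} (V : EuclideanSpace ℝ (Fin d) → ℝ)
    (x : EuclideanSpace ℝ (Fin d)) : ℝ :=
  sSup {r : ℝ | 0 < r ∧ 1 / r ^ ((d : ℝ) - 2) * ∫ y in Metric.ball x r, V y ≤ 1}

/-- `C₀ ≥ 1` and `N₀ > 0` are constants for the slow variation of `ρ`:
`C₀⁻¹ (1 + |x-y|/ρ(x))^{-N₀} ≤ ρ(y)/ρ(x) ≤ C₀ (1 + |x-y|/ρ(x))^{N₀/(N₀+1)}`. -/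
def SlowVariation {d : ℕ} (ρ : EuclideanSpace ℝ (Fin d) → ℝ) (C₀ N₀ : ℝ) : Prop :=
  1 ≤ C₀ ∧ 0 < N₀ ∧ ∀ x y : EuclideanSpace ℝ (Fin d),
    1 / C₀ * (1 + dist x y / ρ x) ^ (-N₀) ≤ ρ y / ρ x ∧
      ρ y / ρ x ≤ C₀ * (1 + dist x y / ρ x) ^ (N₀ / (N₀ + 1))

/-- `f(x) - ess inf_S f` as an element of `[0, ∞]`. The essential infimum is taken in the
extended reals, so the value is `∞` when `f` is not essentially bounded below on `S`; at the
points (a null subset of `S`) where the difference is negative the value is `0`. -/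
def lowerOsc {d : ℕ} (f : EuclideanSpace ℝ (Fin d) → ℝ) (S : Set (EuclideanSpace ℝ (Fin d)))
    (x : EuclideanSpace ℝ (Fin d)) : ℝ≥0∞ :=
  ((f x : EReal) - essInf (fun y => (f y : EReal)) (volume.restrict S)).toENNReal

/-- The `BLO_{ρ,θ}`-constant of `f`, as an element of `[0, ∞]`. -/
def bloConst {d : ℕ} (ρ : EuclideanSpace ℝ (Fin d) → ℝ) (θ : ℝ)
    (f : EuclideanSpace ℝ (Fin d) → ℝ) : ℝ≥0∞ :=
  ⨆ (x₀ : EuclideanSpace ℝ (Fin d)) (r : ℝ) (_ : 0 < r),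
    ENNReal.ofReal ((1 + r / ρ x₀) ^ (-θ)) * mean (cube x₀ r) (lowerOsc f (cube x₀ r))

/-- Membership in the space `BLO_{ρ,θ}`. -/
def MemBLO {d : ℕ} (ρ : EuclideanSpace ℝ (Fin d) → ℝ) (θ : ℝ)
    (f : EuclideanSpace ℝ (Fin d) → ℝ) : Prop :=
  LocallyIntegrable f ∧ bloConst ρ θ f < ∞

/-- The characteristic constant `[ω]_{A^{ρ,θ}_{p,q}}`, as an element of `[0, ∞]`, for `1 ≤ p`
and `0 < q`; a negative power of `0` is `∞`. -/
def apqConst {d : ℕ} (ρ : EuclideanSpace ℝ (Fin d) → ℝ) (θ p q : ℝ)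
    (ω : EuclideanSpace ℝ (Fin d) → ℝ) : ℝ≥0∞ :=
  ⨆ (x₀ : EuclideanSpace ℝ (Fin d)) (r : ℝ) (_ : 0 < r),
    ENNReal.ofReal ((1 + r / ρ x₀) ^ (-θ)) *
      mean (Metric.ball x₀ r) (fun x => ENNReal.ofReal (ω x) ^ q) ^ (1 / q) *
      (if p = 1 then
        (essInf (fun x => ENNReal.ofReal (ω x)) (volume.restrict (Metric.ball x₀ r)))⁻¹
      else
        mean (Metric.ball x₀ r) (fun x => ENNReal.ofReal (ω x) ^ (-(p / (p - 1)))) ^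
          (1 / (p / (p - 1))))

/-- Membership in the class `A^{ρ,θ}_{p,q}`: a nonnegative locally integrable function, not
almost everywhere zero, whose characteristic constant is finite. -/
def MemApq {d : ℕ} (ρ : EuclideanSpace ℝ (Fin d) → ℝ) (θ p q : ℝ)
    (ω : EuclideanSpace ℝ (Fin d) → ℝ) : Prop :=
  (∀ x, 0 ≤ ω x) ∧ LocallyIntegrable ω ∧ ¬ (ω =ᵐ[volume] 0) ∧ apqConst ρ θ p q ω < ∞

/-- `ω^γ(E) = ∫_E ω^γ`. -/
def powMass {d : ℕ} (ω : EuclideanSpace ℝ (Fin d) → ℝ) (γ : ℝ)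
    (E : Set (EuclideanSpace ℝ (Fin d))) : ℝ≥0∞ :=
  ∫⁻ x in E, ENNReal.ofReal (ω x) ^ γ

/-- The comparison `ω^γ(E) ≤ K (|E|/|Q|)^δ (1 + r/ρ(x₀))^η ω^γ(Q)` for all cubes `Q = Q(x₀,r)` and
all measurable subsets `E` of `Q`. -/
def MassComparison {d : ℕ} (ρ : EuclideanSpace ℝ (Fin d) → ℝ) (δ η K : ℝ)
    (ω : EuclideanSpace ℝ (Fin d) → ℝ) (γ : ℝ) : Prop :=
  ∀ (x₀ : EuclideanSpace ℝ (Fin d)) (r : ℝ), 0 < r →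
    ∀ E : Set (EuclideanSpace ℝ (Fin d)), MeasurableSet E → E ⊆ cube x₀ r →
      powMass ω γ E ≤
        ENNReal.ofReal K * (volume E / volume (cube x₀ r)) ^ δ *
          ENNReal.ofReal ((1 + r / ρ x₀) ^ η) * powMass ω γ (cube x₀ r)

/-- `( ω^q(S)⁻¹ ∫_S [f - ess inf_S f]^q ω^q )^{1/q}`. -/
def weightedLowerOsc {d : ℕ} (q : ℝ) (ω f : EuclideanSpace ℝ (Fin d) → ℝ)
    (S : Set (EuclideanSpace ℝ (Fin d))) : ℝ≥0∞ :=
  ((powMass ω q S)⁻¹ * ∫⁻ x in S, lowerOsc f S x ^ q * ENNReal.ofReal (ω x) ^ q) ^ (1 / q)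

end Schrodinger

end

section

open Set Filter
open scoped Topology

noncomputable section

namespace Schrodinger

/-! ### Cubes, dyadic subcubes and the Calderón–Zygmund decomposition of a set. -/

section

variable {d : ℕ}

/-! Everything about the weights comes from one inequality, `mean_mul_powMass_le`: writing g =
(gω)ω⁻¹, Hölder with exponents p, p' and then Jensen from p to q bound the mean of g over a cube by
a constant times [ω](1 + r/ρ)^θ₂ times its normalised L^q(ω^q) norm. With g the lower oscillation of
f this is part (2): the exponents θ₂ and θ₁ - θ₂ add up to θ₁, and one of the two resulting factors
[ω] is absorbed in M.

With g the indicator of the complement of a set F that fills at most half of a cube of side at most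
ρ(centre), the same inequality shows that F carries at most a fraction β < 1 of the ω^q-mass.
Iteration over Calderón–Zygmund cubes turns this into a power of |E|/|Q|
(`measure_le_rpow_mul_of_half`). An arbitrary cube is cut into dyadic cells so small that, by slow
variation of ρ, all their subcubes are in this regime; the number of cells is at most a constant
times a power of 1 + r/ρ(x₀), and this gives (b).

For part (1), slow variation bounds the mean lower oscillation of f over every subcube of Q by A =
C(1 + r/ρ(x₀))^{(N₀+1)θ₁}‖f‖. A John–Nirenberg argument (`volume_superlevel_le`) then makes the
level sets {f ≥ ess inf + kl}, with l = 2^{d+1}A, decay like 2^{-k}. By (b) their ω^q-masses decay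
like 2^{-kδ}, and summation over k gives the L^q bound, with (1 + r/ρ)^η entering to the power 1/q.
The factor [ω] costs nothing because it is bounded below.

For (a), the exponent d/2 is scale invariant: reverse Hölder and Jensen make r^{2-d}∫_B V comparable
to (∫_B V^{d/2})^{2/d}. The integral inside is additive and doubling, hence reverse doubling, so
r^{2-d}∫_B V decays like a power of r (`exists_ballGrowth`); no self-improvement of the reverse
Hölder exponent is needed. Decay together with doubling of V dx yields the slow variation of ρ
(`BallGrowth.exists_slowVariation`). -/

lemma cube_eq_preimage (x : EuclideanSpace ℝ (Fin d)) (r : ℝ) :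
    cube x r = WithLp.ofLp ⁻¹' (univ.pi fun i => Ioo (x i - r / 2) (x i + r / 2)) := by
  ext y
  simp only [cube, mem_ofPred_eq, mem_preimage, mem_univ_pi, mem_Ioo, abs_lt]
  exact forall_congr' fun i => ⟨fun h => ⟨by linarith, by linarith⟩,
    fun h => ⟨by linarith, by linarith⟩⟩

lemma isOpen_cube (x : EuclideanSpace ℝ (Fin d)) (r : ℝ) : IsOpen (cube x r) := by
  rw [cube_eq_preimage]
  exact (isOpen_set_pi finite_univ fun i _ => isOpen_Ioo).preimage (PiLp.continuous_ofLp 2 _)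

lemma measurableSet_cube (x : EuclideanSpace ℝ (Fin d)) (r : ℝ) : MeasurableSet (cube x r) :=
  (isOpen_cube x r).measurableSet

lemma volume_cube (x : EuclideanSpace ℝ (Fin d)) (r : ℝ) :
    volume (cube x r) = ENNReal.ofReal r ^ d := by
  rw [cube_eq_preimage, (PiLp.volume_preserving_ofLp (Fin d)).measure_preimage
    (MeasurableSet.univ_pi fun i => measurableSet_Ioo).nullMeasurableSet, Real.volume_pi_Ioo]
  simp

lemma volume_cube_ne_top (x : EuclideanSpace ℝ (Fin d)) (r : ℝ) : volume (cube x r) ≠ ∞ := by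
  rw [volume_cube]; exact ENNReal.pow_ne_top ENNReal.ofReal_ne_top

lemma volume_cube_pos (x : EuclideanSpace ℝ (Fin d)) {r : ℝ} (hr : 0 < r) :
    0 < volume (cube x r) := by
  rw [volume_cube]
  exact ENNReal.pow_pos (ENNReal.ofReal_pos.2 hr) d

lemma mem_cube_self (x : EuclideanSpace ℝ (Fin d)) {r : ℝ} (hr : 0 < r) : x ∈ cube x r := by
  intro i; simpa using hr

/-- The closed cube centred at `x` with side length `r`. -/
def closedCube (x : EuclideanSpace ℝ (Fin d)) (r : ℝ) : Set (EuclideanSpace ℝ (Fin d)) :=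
  WithLp.ofLp ⁻¹' Metric.closedBall (WithLp.ofLp x) (r / 2)

lemma cube_subset_closedCube (x : EuclideanSpace ℝ (Fin d)) {r : ℝ} (hr : 0 ≤ r) :
    cube x r ⊆ closedCube x r := by
  intro y hy
  rw [closedCube, mem_preimage, Metric.mem_closedBall, dist_pi_le_iff (by positivity)]
  intro i
  rw [Real.dist_eq]
  exact (hy i).le

lemma volume_closedCube (x : EuclideanSpace ℝ (Fin d)) {r : ℝ} (hr : 0 ≤ r) :
    volume (closedCube x r) = ENNReal.ofReal r ^ d := by
  rw [closedCube, (PiLp.volume_preserving_ofLp (Fin d)).measure_preimage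
    measurableSet_closedBall.nullMeasurableSet, Real.volume_pi_closedBall _ (by positivity),
    ENNReal.ofReal_pow (by positivity)]
  simp [mul_div_cancel₀]

/-- The open and the closed cube have the same finite volume. This allows passing freely between
half-open cells, which partition space, and open cubes. -/
lemma ae_eq_cube {x : EuclideanSpace ℝ (Fin d)} {r : ℝ} (hr : 0 ≤ r)
    {S : Set (EuclideanSpace ℝ (Fin d))} (h₁ : cube x r ⊆ S) (h₂ : S ⊆ closedCube x r) :
    S =ᵐ[volume] cube x r := by
  have hle : volume S ≤ volume (cube x r) := by
    rw [volume_cube, ← volume_closedCube x hr]; exact measure_mono h₂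
  exact (ae_eq_of_subset_of_measure_ge h₁ hle (measurableSet_cube x r).nullMeasurableSet
    (hle.trans_lt (volume_cube_ne_top x r).lt_top).ne).symm

/-- The index of the dyadic subcube of generation `n` of the cube `Q(x₀, r)` containing `x`. -/
def dyadicIndex (x₀ : EuclideanSpace ℝ (Fin d)) (r : ℝ) (n : ℕ) (x : EuclideanSpace ℝ (Fin d)) :
    Fin d → ℤ :=
  fun i => ⌊(x i - (x₀ i - r / 2)) / r * 2 ^ n⌋

/-- The half-open dyadic subcube of generation `n` with index `k`. -/
def dyadicCell (x₀ : EuclideanSpace ℝ (Fin d)) (r : ℝ) (n : ℕ) (k : Fin d → ℤ) :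
    Set (EuclideanSpace ℝ (Fin d)) :=
  {x | dyadicIndex x₀ r n x = k}

/-- The centre of a dyadic subcube. -/
def dyadicCenter (x₀ : EuclideanSpace ℝ (Fin d)) (r : ℝ) (n : ℕ) (k : Fin d → ℤ) :
    EuclideanSpace ℝ (Fin d) :=
  WithLp.toLp 2 fun i => x₀ i - r / 2 + (k i + 1 / 2) * (r / 2 ^ n)

lemma dyadicIndex_succ (x₀ : EuclideanSpace ℝ (Fin d)) (r : ℝ) (n : ℕ)
    (x : EuclideanSpace ℝ (Fin d)) (i : Fin d) :
    dyadicIndex x₀ r n x i = dyadicIndex x₀ r (n + 1) x i / 2 := by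
  have := Int.floor_div_natCast ((x i - (x₀ i - r / 2)) / r * 2 ^ (n + 1)) 2
  simp only [dyadicIndex]
  rw [Nat.cast_ofNat] at this
  rw [← show ((2 : ℕ) : ℤ) = 2 from rfl, ← this]
  congr 1
  rw [pow_succ]; push_cast; ring

lemma dyadicIndex_eq_of_le (x₀ : EuclideanSpace ℝ (Fin d)) (r : ℝ) {m n : ℕ} (hmn : m ≤ n)
    {x y : EuclideanSpace ℝ (Fin d)} (h : dyadicIndex x₀ r n x = dyadicIndex x₀ r n y) :
    dyadicIndex x₀ r m x = dyadicIndex x₀ r m y := by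
  induction n, hmn using Nat.le_induction with
  | base => exact h
  | succ n _ ih =>
    apply ih
    funext i
    rw [dyadicIndex_succ, dyadicIndex_succ x₀ r n y, h]

lemma dyadicCell_subset (x₀ : EuclideanSpace ℝ (Fin d)) (r : ℝ) {m n : ℕ} (hmn : m ≤ n)
    {k l : Fin d → ℤ} (h : (dyadicCell x₀ r n k ∩ dyadicCell x₀ r m l).Nonempty) :
    dyadicCell x₀ r n k ⊆ dyadicCell x₀ r m l := by
  obtain ⟨x, hx, hx'⟩ := h
  intro y hy
  exact (dyadicIndex_eq_of_le x₀ r hmn (hy.trans hx.symm)).trans hx'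

lemma mem_dyadicCell_iff {x₀ : EuclideanSpace ℝ (Fin d)} {r : ℝ} (hr : 0 < r) {n : ℕ}
    {k : Fin d → ℤ} {x : EuclideanSpace ℝ (Fin d)} :
    x ∈ dyadicCell x₀ r n k ↔ ∀ i, x₀ i - r / 2 + k i * (r / 2 ^ n) ≤ x i ∧
      x i < x₀ i - r / 2 + (k i + 1) * (r / 2 ^ n) := by
  simp only [dyadicCell, mem_ofPred_eq, funext_iff, dyadicIndex, Int.floor_eq_iff]
  refine forall_congr' fun i => ?_
  have e : x i = x₀ i - r / 2 + ((x i - (x₀ i - r / 2)) / r * 2 ^ n) * (r / 2 ^ n) := by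
    field_simp; ring
  have hp : 0 < r / 2 ^ n := by positivity
  generalize (x i - (x₀ i - r / 2)) / r * 2 ^ n = t at *
  rw [e]
  constructor
  · rintro ⟨h1, h2⟩
    exact ⟨by nlinarith, by nlinarith⟩
  · rintro ⟨h1, h2⟩
    exact ⟨le_of_mul_le_mul_right (by linarith) hp, lt_of_mul_lt_mul_right (by linarith) hp.le⟩

lemma cube_subset_dyadicCell (x₀ : EuclideanSpace ℝ (Fin d)) {r : ℝ} (hr : 0 < r) (n : ℕ)
    (k : Fin d → ℤ) : cube (dyadicCenter x₀ r n k) (r / 2 ^ n) ⊆ dyadicCell x₀ r n k := by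
  intro x hx
  rw [mem_dyadicCell_iff hr]
  intro i
  have := abs_lt.1 (hx i)
  simp only [dyadicCenter] at this
  constructor <;> linarith [this.1, this.2]

lemma dyadicCell_subset_closedCube (x₀ : EuclideanSpace ℝ (Fin d)) {r : ℝ} (hr : 0 < r) (n : ℕ)
    (k : Fin d → ℤ) : dyadicCell x₀ r n k ⊆ closedCube (dyadicCenter x₀ r n k) (r / 2 ^ n) := by
  intro x hx
  rw [mem_dyadicCell_iff hr] at hx
  rw [closedCube, mem_preimage, Metric.mem_closedBall, dist_pi_le_iff (by positivity)]
  intro i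
  rw [Real.dist_eq, abs_le]
  simp only [dyadicCenter]
  constructor <;> linarith [(hx i).1, (hx i).2]

lemma dyadicCell_ae_eq (x₀ : EuclideanSpace ℝ (Fin d)) {r : ℝ} (hr : 0 < r) (n : ℕ)
    (k : Fin d → ℤ) :
    dyadicCell x₀ r n k =ᵐ[volume] cube (dyadicCenter x₀ r n k) (r / 2 ^ n) :=
  ae_eq_cube (by positivity) (cube_subset_dyadicCell x₀ hr n k)
    (dyadicCell_subset_closedCube x₀ hr n k)

lemma measurable_dyadicIndex (x₀ : EuclideanSpace ℝ (Fin d)) (r : ℝ) (n : ℕ) :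
    Measurable (dyadicIndex x₀ r n) := by
  refine measurable_pi_lambda _ fun i => ?_
  unfold dyadicIndex
  exact Int.measurable_floor.comp (by fun_prop)

lemma measurableSet_dyadicCell (x₀ : EuclideanSpace ℝ (Fin d)) (r : ℝ) (n : ℕ)
    (k : Fin d → ℤ) : MeasurableSet (dyadicCell x₀ r n k) :=
  measurable_dyadicIndex x₀ r n (measurableSet_singleton k)

lemma volume_dyadicCell (x₀ : EuclideanSpace ℝ (Fin d)) {r : ℝ} (hr : 0 < r) (n : ℕ)
    (k : Fin d → ℤ) : volume (dyadicCell x₀ r n k) = ENNReal.ofReal (r / 2 ^ n) ^ d := by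
  rw [measure_congr (dyadicCell_ae_eq x₀ hr n k), volume_cube]

lemma volume_dyadicCell_eq_two_pow_mul (x₀ : EuclideanSpace ℝ (Fin d)) {r : ℝ} (hr : 0 < r)
    (m n : ℕ) (k l : Fin d → ℤ) : volume (dyadicCell x₀ r m k) =
      2 ^ (n * d) * volume (dyadicCell x₀ r (m + n) l) := by
  rw [volume_dyadicCell x₀ hr, volume_dyadicCell x₀ hr, pow_mul, ← mul_pow]
  congr 1
  rw [show (2 : ℝ≥0∞) ^ n = ENNReal.ofReal (2 ^ n) by
      rw [ENNReal.ofReal_pow (by norm_num)]; simp, ← ENNReal.ofReal_mul (by positivity)]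
  congr 1
  rw [pow_add]; field_simp

lemma dyadicCenter_zero (x₀ : EuclideanSpace ℝ (Fin d)) (r : ℝ) :
    dyadicCenter x₀ r 0 0 = x₀ := by
  ext i; simp [dyadicCenter]; ring

lemma cube_subset_dyadicCell_zero (x₀ : EuclideanSpace ℝ (Fin d)) {r : ℝ} (hr : 0 < r) :
    cube x₀ r ⊆ dyadicCell x₀ r 0 0 := by
  simpa [dyadicCenter_zero] using cube_subset_dyadicCell x₀ hr 0 0

/-- A cell meeting Q lies in the generation-zero cell, hence in the closed cube; an open subset of
the closed cube lies in its interior, which is Q. -/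
lemma cube_dyadicCenter_subset {x₀ : EuclideanSpace ℝ (Fin d)} {r : ℝ} (hr : 0 < r) {n : ℕ}
    {k : Fin d → ℤ} (h : (dyadicCell x₀ r n k ∩ cube x₀ r).Nonempty) :
    cube (dyadicCenter x₀ r n k) (r / 2 ^ n) ⊆ cube x₀ r := by
  have h1 : cube (dyadicCenter x₀ r n k) (r / 2 ^ n) ⊆ interior (closedCube x₀ r) := by
    apply interior_maximal _ (isOpen_cube _ _)
    refine (cube_subset_dyadicCell x₀ hr n k).trans ?_
    refine (dyadicCell_subset x₀ r (Nat.zero_le n) (l := 0)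
      (h.mono (inter_subset_inter_right _ (cube_subset_dyadicCell_zero x₀ hr)))).trans ?_
    simpa [dyadicCenter_zero] using dyadicCell_subset_closedCube x₀ hr 0 0
  refine h1.trans ?_
  have : closedCube x₀ r = (PiLp.homeomorph 2 (fun _ : Fin d => ℝ)) ⁻¹'
    (univ.pi fun i => Icc (x₀ i - r / 2) (x₀ i + r / 2)) := by
    rw [closedCube, closedBall_pi _ (by positivity)]
    simp only [Real.closedBall_eq_Icc]
    rfl
  rw [this, ← Homeomorph.preimage_interior, interior_pi_set finite_univ, cube_eq_preimage]
  simp only [interior_Icc]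
  exact subset_rfl

/-- In the sup norm the cells are, up to null sets, closed balls of radius tending to 0. The
Lebesgue density theorem for doubling measures only asks that x belong to these balls, not that it
be their centre. -/
lemma ae_tendsto_measure_inter_dyadicCell (x₀ : EuclideanSpace ℝ (Fin d)) {r : ℝ} (hr : 0 < r)
    {S : Set (EuclideanSpace ℝ (Fin d))} (hS : MeasurableSet S) :
    ∀ᵐ x ∂volume.restrict S, Tendsto (fun n =>
      volume (S ∩ dyadicCell x₀ r n (dyadicIndex x₀ r n x)) /
        volume (dyadicCell x₀ r n (dyadicIndex x₀ r n x))) atTop (𝓝 1) := by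
  have hmp := PiLp.volume_preserving_ofLp (Fin d)
  have hmp' := PiLp.volume_preserving_toLp (Fin d)
  set S' : Set (Fin d → ℝ) := WithLp.toLp 2 ⁻¹' S with hS'
  have hSm' : MeasurableSet S' := hmp'.measurable hS
  have hSS : WithLp.ofLp ⁻¹' S' = S := by ext x; simp [hS']
  have key := IsUnifLocDoublingMeasure.ae_tendsto_measure_inter_div
    (volume : Measure (Fin d → ℝ)) S' 1
  rw [ae_restrict_iff' hSm'] at key
  rw [ae_restrict_iff' hS]
  filter_upwards [hmp.quasiMeasurePreserving.ae key] with x hx hxS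
  have hx' := hx (by simpa [hS'] using hxS)
    (fun n => WithLp.ofLp (dyadicCenter x₀ r n (dyadicIndex x₀ r n x)))
    (fun n : ℕ => r / 2 ^ n / 2) (l := atTop) ?_ ?_
  · refine hx'.congr fun n => ?_
    have hcl : dyadicCell x₀ r n (dyadicIndex x₀ r n x) =ᵐ[volume]
        closedCube (dyadicCenter x₀ r n (dyadicIndex x₀ r n x)) (r / 2 ^ n) :=
      (dyadicCell_ae_eq x₀ hr n _).trans (ae_eq_cube (by positivity)
        (cube_subset_closedCube _ (by positivity)) subset_rfl).symm
    rw [measure_congr hcl, measure_congr ((ae_eq_refl S).inter hcl)]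
    conv_rhs => rw [← hSS]
    rw [closedCube, ← preimage_inter, hmp.measure_preimage
      (hSm'.inter measurableSet_closedBall).nullMeasurableSet, hmp.measure_preimage
      measurableSet_closedBall.nullMeasurableSet]
  · rw [tendsto_nhdsWithin_iff]
    refine ⟨?_, Eventually.of_forall fun n => by simp only [mem_Ioi]; positivity⟩
    have := (tendsto_pow_atTop_nhds_zero_of_lt_one (r := (1 / 2 : ℝ)) (by norm_num)
      (by norm_num)).const_mul (r / 2)
    rw [mul_zero] at this
    refine this.congr fun n => ?_
    rw [div_pow, one_pow]; ring
  · refine Eventually.of_forall fun n => ?_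
    rw [one_mul]
    exact dyadicCell_subset_closedCube x₀ hr n _ rfl

/-- The Calderón–Zygmund decomposition of a set: a subset `S` of a cube of density at most `α` is
covered, up to a null set, by disjoint subcubes in which its density lies in `(α, 2 ^ d α]`. -/
theorem exists_calderonZygmund_cubes (x₀ : EuclideanSpace ℝ (Fin d)) {r : ℝ} (hr : 0 < r)
    {S : Set (EuclideanSpace ℝ (Fin d))} (hS : MeasurableSet S) (hSQ : S ⊆ cube x₀ r)
    {α : ℝ≥0∞} (hα : α < 1) (hSα : volume S ≤ α * volume (cube x₀ r)) :
    ∃ (ι : Type) (_ : Countable ι) (c : ι → EuclideanSpace ℝ (Fin d)) (t : ι → ℝ),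
      (∀ j, 0 < t j) ∧ (∀ j, cube (c j) (t j) ⊆ cube x₀ r) ∧
      Pairwise (fun i j => Disjoint (cube (c i) (t i)) (cube (c j) (t j))) ∧
      volume (S \ ⋃ j, cube (c j) (t j)) = 0 ∧
      ∀ j, α * volume (cube (c j) (t j)) < volume (S ∩ cube (c j) (t j)) ∧
        volume (S ∩ cube (c j) (t j)) ≤ 2 ^ d * α * volume (cube (c j) (t j)) := by
  classical
  set D := dyadicCell x₀ r with hD
  set I := dyadicIndex x₀ r with hI
  set P : ℕ → (Fin d → ℤ) → Prop := fun n k => α * volume (D n k) < volume (S ∩ D n k) with hP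
  -- The stopping cells: density above α, while no ancestor has density above α.
  set J : Set (ℕ × (Fin d → ℤ)) :=
    {a | P a.1 a.2 ∧ ∀ m < a.1, ∀ x ∈ D a.1 a.2, ¬ P m (I m x)} with hJ
  have hvol : ∀ n k, volume (S ∩ D n k) =
      volume (S ∩ cube (dyadicCenter x₀ r n k) (r / 2 ^ n)) := fun n k =>
    measure_congr ((ae_eq_refl S).inter (dyadicCell_ae_eq x₀ hr n k))
  have hvol' : ∀ n k, volume (D n k) = volume (cube (dyadicCenter x₀ r n k) (r / 2 ^ n)) :=
    fun n k => measure_congr (dyadicCell_ae_eq x₀ hr n k)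
  have hne : ∀ a ∈ J, (S ∩ D a.1 a.2).Nonempty := fun a ha =>
    nonempty_of_measure_ne_zero (ne_bot_of_gt ha.1)
  have hdisj : ∀ a ∈ J, ∀ b ∈ J, ∀ x, x ∈ D a.1 a.2 → x ∈ D b.1 b.2 → a = b := by
    intro a ha b hb x hxa hxb
    have hxa' : I a.1 x = a.2 := hxa
    have hxb' : I b.1 x = b.2 := hxb
    rcases lt_trichotomy a.1 b.1 with h | h | h
    · exact absurd (hxa' ▸ ha.1) (hb.2 a.1 h x hxb)
    · exact Prod.ext h (by rw [← hxa', ← hxb', h])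
    · exact absurd (hxb' ▸ hb.1) (ha.2 b.1 h x hxa)
  refine ⟨J, inferInstance, fun j => dyadicCenter x₀ r j.1.1 j.1.2, fun j => r / 2 ^ j.1.1,
    fun j => by positivity, ?_, ?_, ?_, ?_⟩
  · rintro ⟨a, ha⟩
    obtain ⟨x, hxS, hx⟩ := hne a ha
    exact cube_dyadicCenter_subset hr ⟨x, hx, hSQ hxS⟩
  · rintro ⟨a, ha⟩ ⟨b, hb⟩ hab
    rw [Set.disjoint_left]
    intro x hxa hxb
    exact hab (Subtype.ext (hdisj a ha b hb x (cube_subset_dyadicCell x₀ hr _ _ hxa)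
      (cube_subset_dyadicCell x₀ hr _ _ hxb)))
  -- At a density point of S the densities along the cells tend to 1 > α, so a first cell of density
  -- above α exists.
  · have h1 : volume (S \ ⋃ j : J, D j.1.1 j.1.2) = 0 := by
      have key := ae_tendsto_measure_inter_dyadicCell x₀ hr hS
      rw [ae_restrict_iff' hS] at key
      refine measure_mono_null ?_ (ae_iff.1 key)
      rintro x ⟨hxS, hx⟩ hcon
      apply hx
      have hev := (hcon hxS).eventually (lt_mem_nhds hα)
      obtain ⟨n, hn⟩ := hev.exists
      have hex : ∃ n, P n (I n x) := ⟨n, by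
        have := (ENNReal.lt_div_iff_mul_lt (Or.inl ?_) (Or.inl ?_)).1 hn
        · exact this
        · rw [volume_dyadicCell x₀ hr]
          exact (ENNReal.pow_pos (ENNReal.ofReal_pos.2 (by positivity)) d).ne'
        · rw [volume_dyadicCell x₀ hr]
          exact ENNReal.pow_ne_top ENNReal.ofReal_ne_top⟩
      refine mem_iUnion.2 ⟨⟨(Nat.find hex, I (Nat.find hex) x), Nat.find_spec hex, ?_⟩, rfl⟩
      intro m hm y hy
      rw [show I m y = I m x from dyadicIndex_eq_of_le x₀ r hm.le (hy : I _ y = I _ x)]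
      exact Nat.find_min hex hm
    have h2 : (S \ ⋃ j : J, cube (dyadicCenter x₀ r j.1.1 j.1.2) (r / 2 ^ j.1.1) :
        Set (EuclideanSpace ℝ (Fin d))) =ᵐ[volume] (S \ ⋃ j : J, D j.1.1 j.1.2 : Set _) :=
      (ae_eq_refl S).diff (Filter.EventuallyEq.countable_iUnion fun j =>
        (dyadicCell_ae_eq x₀ hr _ _).symm)
    rw [measure_congr h2, h1]
  · rintro ⟨⟨n, k⟩, ha⟩
    refine ⟨?_, ?_⟩
    · have := ha.1
      simp only [hP] at this
      rwa [hvol', hvol] at this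
    · obtain ⟨x, hxS, hx⟩ := hne _ ha
      dsimp only at hx ⊢
      rw [← hvol, ← hvol']
      -- Generation 0 is never selected, since S has density at most α in the whole cube. Otherwise
      -- the parent was not selected, and it is 2^d times as large as the cell.
      rcases n with _ | m
      · exfalso
        have hk : k = 0 := by
          have : I 0 x = 0 := cube_subset_dyadicCell_zero x₀ hr (hSQ hxS)
          exact (hx : I 0 x = k).symm.trans this
        have h0 := ha.1
        simp only [hP, hk] at h0
        have h3 : volume (D 0 0) = volume (cube x₀ r) := by
          rw [hvol' 0 0]; simp [dyadicCenter_zero]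
        rw [h3] at h0
        exact absurd ((measure_mono inter_subset_left).trans hSα) (not_le.2 h0)
      · have h4 := not_lt.1 (ha.2 m (Nat.lt_succ_self m) x hx)
        have h5 : D (m + 1) k ⊆ D m (I m x) :=
          dyadicCell_subset x₀ r (Nat.le_succ m) ⟨x, hx, rfl⟩
        refine (measure_mono (inter_subset_inter_right S h5)).trans (h4.trans ?_)
        rw [hD, volume_dyadicCell_eq_two_pow_mul x₀ hr m 1 _ k, one_mul, ← mul_assoc,
          mul_comm α]

end

/-! ### Two iterations of the decomposition: decay of a measure, and the John–Nirenberg inequality.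
-/

section

variable {d : ℕ}

lemma measure_eq_tsum_inter {ν : Measure (EuclideanSpace ℝ (Fin d))} (hν : ν ≪ volume)
    {ι : Type} [Countable ι] {c : ι → EuclideanSpace ℝ (Fin d)} {t : ι → ℝ}
    (hdisj : Pairwise (fun i j => Disjoint (cube (c i) (t i)) (cube (c j) (t j))))
    {S : Set (EuclideanSpace ℝ (Fin d))} (hS : MeasurableSet S)
    (h0 : volume (S \ ⋃ j, cube (c j) (t j)) = 0) :
    ν S = ∑' j, ν (S ∩ cube (c j) (t j)) := by
  have hU : MeasurableSet (⋃ j, cube (c j) (t j)) :=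
    MeasurableSet.iUnion fun j => measurableSet_cube _ _
  rw [← measure_inter_add_sdiff S hU, hν h0, add_zero, inter_iUnion, measure_iUnion]
  · exact fun i j hij => (hdisj hij).mono inter_subset_right inter_subset_right
  · exact fun j => hS.inter (measurableSet_cube _ _)

lemma two_pow_mul_inv_two_pow_succ : (2 : ℝ≥0∞) ^ d * (2 ^ (d + 1))⁻¹ = 2⁻¹ := by
  rw [pow_succ, ENNReal.mul_inv (by simp) (by simp), ← mul_assoc, ENNReal.mul_inv_cancel
    (by simp) (by simp), one_mul]

lemma inv_two_pow_succ_lt_one : ((2 : ℝ≥0∞) ^ (d + 1))⁻¹ < 1 := by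
  rw [ENNReal.inv_lt_one]
  exact one_lt_pow₀ (by norm_num) (by simp)

/-- If `ν F ≤ β ν Q'` whenever `F` occupies at most half of a subcube `Q'` of `Q`, then `ν S` decays
geometrically with the density of `S` in `Q`. -/
theorem measure_le_pow_mul_of_half {ν : Measure (EuclideanSpace ℝ (Fin d))} (hν : ν ≪ volume)
    {x₀ : EuclideanSpace ℝ (Fin d)} {r : ℝ} (hr : 0 < r) {β : ℝ≥0∞}
    (hβ : ∀ c t, 0 < t → cube c t ⊆ cube x₀ r → ∀ F, MeasurableSet F → F ⊆ cube c t →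
      volume F ≤ 2⁻¹ * volume (cube c t) → ν F ≤ β * ν (cube c t)) (k : ℕ)
    {S : Set (EuclideanSpace ℝ (Fin d))} (hS : MeasurableSet S) (hSQ : S ⊆ cube x₀ r)
    (hSk : volume S ≤ ((2 ^ (d + 1))⁻¹) ^ k * volume (cube x₀ r)) :
    ν S ≤ β ^ k * ν (cube x₀ r) := by
  induction k generalizing S with
  | zero => simpa using measure_mono hSQ
  | succ k ih =>
    -- At this height the selected cubes have density at most 2^d α = 1/2, so that `hβ` applies in
    -- each of them.
    set α : ℝ≥0∞ := (2 ^ (d + 1))⁻¹ with hα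
    have hα1 : α < 1 := inv_two_pow_succ_lt_one
    obtain ⟨ι, _, c, t, ht, hsub, hdisj, hcov, hbd⟩ := exists_calderonZygmund_cubes x₀ hr hS hSQ hα1
      (hSk.trans (by
        gcongr
        exact pow_le_of_le_one zero_le hα1.le (by simp)))
    set U := ⋃ j, cube (c j) (t j) with hU
    have hUm : MeasurableSet U := MeasurableSet.iUnion fun j => measurableSet_cube _ _
    have hUsum : ∀ ν' : Measure (EuclideanSpace ℝ (Fin d)), ν' U = ∑' j, ν' (cube (c j) (t j)) :=
      fun ν' => measure_iUnion hdisj fun j => measurableSet_cube _ _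
    -- The union U of the selected cubes exceeds S in volume by a factor of at most α⁻¹, so one
    -- power of α is lost, while passing from ν U to ν S gains one power of β.
    have hUvol : α * volume U ≤ volume S := by
      rw [hUsum, measure_eq_tsum_inter Measure.AbsolutelyContinuous.rfl hdisj hS hcov,
        ← ENNReal.tsum_mul_left]
      exact ENNReal.tsum_le_tsum fun j => (hbd j).1.le
    have hU' : ν U ≤ β ^ k * ν (cube x₀ r) := by
      refine ih hUm (iUnion_subset hsub) ?_
      have h1 : α * volume U ≤ α * (α ^ k * volume (cube x₀ r)) := by
        rw [← mul_assoc, ← pow_succ']; exact hUvol.trans hSk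
      exact (ENNReal.mul_le_mul_iff_right (by simp [hα]) (by simp [hα])).1 h1
    calc ν S = ∑' j, ν (S ∩ cube (c j) (t j)) := measure_eq_tsum_inter hν hdisj hS hcov
      _ ≤ ∑' j, β * ν (cube (c j) (t j)) := by
        refine ENNReal.tsum_le_tsum fun j => ?_
        refine hβ _ _ (ht j) (hsub j) _ (hS.inter (measurableSet_cube _ _)) inter_subset_right ?_
        have := (hbd j).2
        rwa [hα, two_pow_mul_inv_two_pow_succ] at this
      _ = β * ν U := by rw [ENNReal.tsum_mul_left, hUsum]
      _ ≤ β * (β ^ k * ν (cube x₀ r)) := by gcongr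
      _ = β ^ (k + 1) * ν (cube x₀ r) := by rw [pow_succ', mul_assoc]

lemma exists_rpow_ge {β : ℝ} (hβ : β < 1) {a : ℝ} (ha : 0 < a) :
    ∃ δ : ℝ, 0 < δ ∧ δ < 1 ∧ β ≤ a ^ δ := by
  have h : Tendsto (fun δ : ℝ => a ^ δ) (𝓝[>] 0) (𝓝 1) := by
    have := (Real.continuousAt_const_rpow (a := a) (b := 0) ha.ne').tendsto
    rw [Real.rpow_zero] at this
    exact this.mono_left nhdsWithin_le_nhds
  have h1 := h.eventually (lt_mem_nhds hβ)
  have h2 : ∀ᶠ δ : ℝ in 𝓝[>] 0, δ ∈ Ioo (0 : ℝ) 1 := Ioo_mem_nhdsGT one_pos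
  obtain ⟨δ, h3, h4⟩ := (h1.and h2).exists
  exact ⟨δ, h4.1, h4.2, h3.le⟩

/-- Interpolates the geometric decay: if α^{k+1} < u ≤ α^k for the density u, then β^k ≤ α^{kδ} =
(2^{d+1}α^{k+1})^δ ≤ 2^{d+1}u^δ. -/
theorem measure_le_rpow_mul_of_half {ν : Measure (EuclideanSpace ℝ (Fin d))} (hν : ν ≪ volume)
    {x₀ : EuclideanSpace ℝ (Fin d)} {r : ℝ} (hr : 0 < r) {β : ℝ≥0∞} {δ : ℝ} (hδ0 : 0 < δ)
    (hδ1 : δ < 1) (hβδ : β ≤ ((2 ^ (d + 1))⁻¹ : ℝ≥0∞) ^ δ)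
    (hβ : ∀ c t, 0 < t → cube c t ⊆ cube x₀ r → ∀ F, MeasurableSet F → F ⊆ cube c t →
      volume F ≤ 2⁻¹ * volume (cube c t) → ν F ≤ β * ν (cube c t))
    {S : Set (EuclideanSpace ℝ (Fin d))} (hS : MeasurableSet S) (hSQ : S ⊆ cube x₀ r) :
    ν S ≤ 2 ^ (d + 1) * (volume S / volume (cube x₀ r)) ^ δ * ν (cube x₀ r) := by
  set α : ℝ≥0∞ := (2 ^ (d + 1))⁻¹ with hα
  have hα1 : α < 1 := inv_two_pow_succ_lt_one
  have hQ0 := (volume_cube_pos x₀ hr).ne'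
  have hQt := volume_cube_ne_top x₀ r
  rcases eq_or_ne (volume S) 0 with h0 | h0
  · rw [hν h0]; exact zero_le
  set u := volume S / volume (cube x₀ r) with hu
  have hSu : volume S = u * volume (cube x₀ r) := (ENNReal.div_mul_cancel hQ0 hQt).symm
  have hu0 : u ≠ 0 := by
    intro h; rw [h, zero_mul] at hSu; exact h0 hSu
  have hu1 : u ≤ 1 := ENNReal.div_le_of_le_mul (by rw [one_mul]; exact measure_mono hSQ)
  classical
  have hex : ∃ k : ℕ, α ^ (k + 1) < u := by
    have := ENNReal.tendsto_pow_atTop_nhds_zero_of_lt_one hα1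
    exact (((tendsto_add_atTop_iff_nat 1).2 this).eventually (gt_mem_nhds hu0.bot_lt)).exists
  set k := Nat.find hex with hk
  have hk1 : α ^ (k + 1) < u := Nat.find_spec hex
  have hk2 : u ≤ α ^ k := by
    rcases Nat.eq_zero_or_pos k with h | h
    · rw [h, pow_zero]; exact hu1
    · have := not_lt.1 (Nat.find_min hex (Nat.sub_lt h one_pos))
      rwa [← hk, show k - 1 + 1 = k by omega] at this
  have h1 := measure_le_pow_mul_of_half hν hr hβ k hS hSQ (by rw [hSu]; gcongr)
  refine h1.trans ?_
  gcongr
  have hαinv : (2 : ℝ≥0∞) ^ (d + 1) * α = 1 := ENNReal.mul_inv_cancel (by simp) (by simp)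
  calc β ^ k ≤ (α ^ δ) ^ k := by gcongr
    _ = (α ^ k) ^ δ := by
      rw [← ENNReal.rpow_natCast, ← ENNReal.rpow_mul, mul_comm, ENNReal.rpow_mul,
        ENNReal.rpow_natCast]
    _ = (2 ^ (d + 1) * α ^ (k + 1)) ^ δ := by
      rw [pow_succ' α, ← mul_assoc, hαinv, one_mul]
    _ = (2 ^ (d + 1)) ^ δ * (α ^ (k + 1)) ^ δ := ENNReal.mul_rpow_of_nonneg _ _ hδ0.le
    _ ≤ 2 ^ (d + 1) * u ^ δ := by
      gcongr
      calc ((2 : ℝ≥0∞) ^ (d + 1)) ^ δ ≤ (2 ^ (d + 1)) ^ (1 : ℝ) :=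
            ENNReal.rpow_le_rpow_of_exponent_le (one_le_pow₀ (by norm_num)) hδ1.le
        _ = _ := ENNReal.rpow_one _

/-- The John–Nirenberg estimate for functions of bounded lower oscillation. -/
theorem volume_superlevel_le {f : EuclideanSpace ℝ (Fin d) → ℝ} (hf : Measurable f)
    {x₀ : EuclideanSpace ℝ (Fin d)} {r : ℝ} (hr : 0 < r) {l m : ℝ} (hl : 0 ≤ l)
    (hsub : ∀ c t, 0 < t → cube c t ⊆ cube x₀ r → ∃ m' : ℝ,
      (∀ᵐ x ∂volume.restrict (cube c t), m' ≤ f x) ∧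
      volume {x ∈ cube c t | m' + l ≤ f x} ≤ (2 ^ (d + 1))⁻¹ * volume (cube c t))
    (hm : volume {x ∈ cube x₀ r | m + l ≤ f x} ≤ (2 ^ (d + 1))⁻¹ * volume (cube x₀ r)) (k : ℕ) :
    volume {x ∈ cube x₀ r | m + k * l ≤ f x} ≤ 2⁻¹ ^ k * volume (cube x₀ r) := by
  have hmeas : ∀ a : ℝ, MeasurableSet {x | a ≤ f x} := fun a => measurableSet_le measurable_const hf
  induction k with
  | zero => simpa using measure_mono (sep_subset _ _)
  | succ k ih =>
    set α : ℝ≥0∞ := (2 ^ (d + 1))⁻¹ with hα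
    have hα1 : α < 1 := inv_two_pow_succ_lt_one
    set S := {x ∈ cube x₀ r | m + (k + 1 : ℕ) * l ≤ f x} with hS
    have hSm : MeasurableSet S := (measurableSet_cube _ _).inter (hmeas _)
    have hSα : volume S ≤ α * volume (cube x₀ r) := by
      refine (measure_mono ?_).trans hm
      rintro x ⟨hx, hx'⟩
      refine ⟨hx, le_trans ?_ hx'⟩
      push_cast
      nlinarith [mul_nonneg k.cast_nonneg hl]
    obtain ⟨ι, _, c, t, ht, hcQ, hdisj, hcov, hbd⟩ :=
      exists_calderonZygmund_cubes x₀ hr hSm (sep_subset _ _) hα1 hSα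
    set T := {x ∈ cube x₀ r | m + k * l ≤ f x} with hT
    have hTm : MeasurableSet T := (measurableSet_cube _ _).inter (hmeas _)
    have hfull : ∀ j, volume (cube (c j) (t j)) ≤ volume (T ∩ cube (c j) (t j)) := by
      intro j
      obtain ⟨m', hm', hm''⟩ := hsub _ _ (ht j) (hcQ j)
      -- The heart of the argument: were the lower bound m' of f on a selected cube below m + kl,
      -- then S would lie there in {f ≥ m' + l}, whose density is at most α, against the selection.
      -- Hence the cube lies in T up to a null set.
      have hmm : m + k * l ≤ m' := by
        by_contra! hlt
        refine absurd ((measure_mono ?_).trans hm'') (not_le.2 (hbd j).1)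
        rintro x ⟨⟨_, hx⟩, hxc⟩
        refine ⟨hxc, le_trans ?_ hx⟩
        push_cast; linarith
      rw [ae_restrict_iff' (measurableSet_cube _ _)] at hm'
      refine measure_mono_ae ?_
      filter_upwards [hm'] with x hx hxc
      exact ⟨⟨hcQ j hxc, hmm.trans (hx hxc)⟩, hxc⟩
    calc volume S = ∑' j, volume (S ∩ cube (c j) (t j)) :=
          measure_eq_tsum_inter Measure.AbsolutelyContinuous.rfl hdisj hSm hcov
      _ ≤ ∑' j, 2⁻¹ * volume (T ∩ cube (c j) (t j)) := by
        refine ENNReal.tsum_le_tsum fun j => (hbd j).2.trans ?_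
        rw [hα, two_pow_mul_inv_two_pow_succ]
        exact mul_le_mul_right (hfull j) _
      _ = 2⁻¹ * volume (⋃ j, T ∩ cube (c j) (t j)) := by
        rw [ENNReal.tsum_mul_left, measure_iUnion]
        · exact fun i j hij => (hdisj hij).mono inter_subset_right inter_subset_right
        · exact fun j => hTm.inter (measurableSet_cube _ _)
      _ ≤ 2⁻¹ * volume T := by
        gcongr
        exact iUnion_subset fun j => inter_subset_left
      _ ≤ 2⁻¹ * (2⁻¹ ^ k * volume (cube x₀ r)) := by gcongr
      _ = _ := by rw [pow_succ', mul_assoc]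

end

/-! ### Nondegeneracy of the weights, and the control of averages by weighted norms. -/

section

variable {d : ℕ}

/-- The dual factor in the `A_{p,q}` characteristic. -/
def apqDual (p : ℝ) (ω : EuclideanSpace ℝ (Fin d) → ℝ) (S : Set (EuclideanSpace ℝ (Fin d))) :
    ℝ≥0∞ :=
  if p = 1 then (essInf (fun x => ENNReal.ofReal (ω x)) (volume.restrict S))⁻¹
  else mean S (fun x => ENNReal.ofReal (ω x) ^ (-(p / (p - 1)))) ^ (1 / (p / (p - 1)))

lemma le_apqConst (ρ : EuclideanSpace ℝ (Fin d) → ℝ) (θ p q : ℝ)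
    (ω : EuclideanSpace ℝ (Fin d) → ℝ) (x : EuclideanSpace ℝ (Fin d)) {r : ℝ} (hr : 0 < r) :
    ENNReal.ofReal ((1 + r / ρ x) ^ (-θ)) *
      mean (Metric.ball x r) (fun x => ENNReal.ofReal (ω x) ^ q) ^ (1 / q) *
      apqDual p ω (Metric.ball x r) ≤ apqConst ρ θ p q ω :=
  le_iSup_of_le x (le_iSup_of_le r (le_iSup_of_le hr le_rfl))

lemma mean_mul_apqDual_le {ρ : EuclideanSpace ℝ (Fin d) → ℝ} (hρ : ∀ x, 0 < ρ x) (θ p q : ℝ)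
    (ω : EuclideanSpace ℝ (Fin d) → ℝ) (x : EuclideanSpace ℝ (Fin d)) {r : ℝ} (hr : 0 < r) :
    mean (Metric.ball x r) (fun x => ENNReal.ofReal (ω x) ^ q) ^ (1 / q) *
      apqDual p ω (Metric.ball x r) ≤
      apqConst ρ θ p q ω * ENNReal.ofReal ((1 + r / ρ x) ^ θ) := by
  have hL : 0 < 1 + r / ρ x := by have := hρ x; positivity
  have h := mul_le_mul_left (le_apqConst ρ θ p q ω x hr) (ENNReal.ofReal ((1 + r / ρ x) ^ θ))
  refine le_trans (le_of_eq ?_) h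
  have h1 : ENNReal.ofReal ((1 + r / ρ x) ^ (-θ)) * ENNReal.ofReal ((1 + r / ρ x) ^ θ) = 1 := by
    rw [← ENNReal.ofReal_mul (by positivity), ← Real.rpow_add hL]; simp
  rw [mul_right_comm, mul_right_comm (ENNReal.ofReal _), h1, one_mul]

section Weights

variable {ρ : EuclideanSpace ℝ (Fin d) → ℝ} {θ p q : ℝ} {ω : EuclideanSpace ℝ (Fin d) → ℝ}

lemma MemApq.aemeasurable (hω : MemApq ρ θ p q ω) :
    AEMeasurable (fun x => ENNReal.ofReal (ω x)) volume :=
  hω.2.1.aestronglyMeasurable.aemeasurable.ennreal_ofReal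

lemma volume_ball_ne_zero (x : EuclideanSpace ℝ (Fin d)) {r : ℝ} (hr : 0 < r) :
    volume (Metric.ball x r) ≠ 0 := (Metric.measure_ball_pos _ _ hr).ne'

lemma volume_ball_ne_top (x : EuclideanSpace ℝ (Fin d)) (r : ℝ) :
    volume (Metric.ball x r) ≠ ∞ := measure_ball_lt_top.ne

lemma ae_pos_of_apqDual_ne_top (hp : 1 ≤ p) (hω : MemApq ρ θ p q ω)
    {x : EuclideanSpace ℝ (Fin d)} {r : ℝ}
    (h : apqDual p ω (Metric.ball x r) ≠ ∞) :
    ∀ᵐ y ∂volume.restrict (Metric.ball x r), 0 < ω y := by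
  unfold apqDual at h
  split_ifs at h with h1
  · have h2 : essInf (fun x => ENNReal.ofReal (ω x)) (volume.restrict (Metric.ball x r)) ≠ 0 := by
      intro h0; rw [h0] at h; simp at h
    filter_upwards [ae_essInf_le (f := fun x => ENNReal.ofReal (ω x))
      (μ := volume.restrict (Metric.ball x r))] with y hy
    exact ENNReal.ofReal_pos.1 (h2.bot_lt.trans_le hy)
  · have hp1 : 1 < p := lt_of_le_of_ne hp (Ne.symm h1)
    have hpp : 0 < p / (p - 1) := div_pos (by linarith) (by linarith)
    have h2 : ∫⁻ y in Metric.ball x r, ENNReal.ofReal (ω y) ^ (-(p / (p - 1))) ≠ ∞ := by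
      intro h0
      apply h
      rw [mean, h0, ENNReal.mul_top (ENNReal.inv_ne_zero.2 (volume_ball_ne_top x r)),
        ENNReal.top_rpow_of_pos (by positivity)]
    have h3 := ae_lt_top' (hω.aemeasurable.restrict.pow_const _) h2
    filter_upwards [h3] with y hy
    by_contra! h0
    rw [ENNReal.ofReal_of_nonpos h0, ENNReal.zero_rpow_of_neg (by linarith)] at hy
    exact lt_irrefl _ hy

/-- The weight is real valued, so neither its essential infimum is infinite nor its negative powers
vanish. -/
lemma apqDual_ne_zero (hp : 1 ≤ p) (hω : MemApq ρ θ p q ω) (x : EuclideanSpace ℝ (Fin d)) {r : ℝ}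
    (hr : 0 < r) : apqDual p ω (Metric.ball x r) ≠ 0 := by
  have hB := volume_ball_ne_zero x hr
  have hne : (ae (volume.restrict (Metric.ball x r))).NeBot := by
    rw [ae_neBot, Ne, Measure.restrict_eq_zero]; exact hB
  unfold apqDual
  split_ifs with h1
  · rw [Ne, ENNReal.inv_eq_zero]
    intro h2
    have h3 := ae_essInf_le (f := fun x => ENNReal.ofReal (ω x))
      (μ := volume.restrict (Metric.ball x r))
    rw [h2] at h3
    obtain ⟨y, hy⟩ := h3.exists
    exact ENNReal.ofReal_ne_top (top_le_iff.1 hy)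
  · have hp1 : 1 < p := lt_of_le_of_ne hp (Ne.symm h1)
    have hpp : 0 < p / (p - 1) := div_pos (by linarith) (by linarith)
    intro h2
    rw [ENNReal.rpow_eq_zero_iff_of_pos (by positivity), mean, mul_eq_zero,
      ENNReal.inv_eq_zero] at h2
    rcases h2 with h2 | h2
    · exact volume_ball_ne_top x r h2
    · rw [lintegral_eq_zero_iff' (hω.aemeasurable.restrict.pow_const _)] at h2
      obtain ⟨y, hy⟩ := h2.exists
      rw [Pi.zero_apply, ENNReal.rpow_eq_zero_iff] at hy
      rcases hy with hy | hy
      · linarith [hy.2]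
      · exact ENNReal.ofReal_ne_top hy.1

/-- On a ball where ω is not almost everywhere zero the mean of ω^q is nonzero, so finiteness of the
characteristic makes the dual factor finite, and this forces ω > 0 there. Since 0 · ∞ = 0, nothing
follows on a ball where ω vanishes, hence the passage to large balls. -/
lemma MemApq.ae_pos (hρ : ∀ x, 0 < ρ x) (hp : 1 ≤ p) (hq : 0 < q) (hω : MemApq ρ θ p q ω) :
    ∀ᵐ y, 0 < ω y := by
  have hU : (⋃ n : ℕ, Metric.ball (0 : EuclideanSpace ℝ (Fin d)) n) = univ := Metric.iUnion_ball_nat 0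
  have hex : ∃ n₀ : ℕ, ¬ ∀ᵐ y ∂volume.restrict (Metric.ball 0 n₀), ω y = 0 := by
    by_contra! h
    apply hω.2.2.1
    have := (ae_restrict_iUnion_iff (fun n : ℕ => Metric.ball (0 : EuclideanSpace ℝ (Fin d)) n)
      (fun y => ω y = 0)).2 h
    rwa [hU, Measure.restrict_univ] at this
  obtain ⟨n₀, hn₀⟩ := hex
  have key : ∀ n : ℕ, ∀ᵐ y ∂volume.restrict (Metric.ball (0 : EuclideanSpace ℝ (Fin d)) n),
      0 < ω y := by
    intro n
    -- The ball must contain both the given ball and one where ω does not vanish; the added 1 makes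
    -- its radius positive.
    set R : ℝ := (max n n₀ : ℕ) + 1 with hR
    have hR0 : 0 < R := by positivity
    have hn : (n : ℝ) ≤ R := by rw [hR]; push_cast; linarith [le_max_left (n : ℝ) n₀]
    have hn' : (n₀ : ℝ) ≤ R := by rw [hR]; push_cast; linarith [le_max_right (n : ℝ) n₀]
    have h1 : apqDual p ω (Metric.ball 0 R) ≠ ∞ := by
      intro htop
      have h2 := (le_apqConst ρ θ p q ω 0 hR0).trans_lt hω.2.2.2
      rw [htop, ENNReal.mul_top] at h2
      · exact lt_irrefl _ h2
      rw [mul_ne_zero_iff]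
      constructor
      · rw [ENNReal.ofReal_ne_zero_iff]
        have := hρ 0
        positivity
      · rw [Ne, ENNReal.rpow_eq_zero_iff_of_pos (by positivity), mean, mul_eq_zero, not_or]
        refine ⟨ENNReal.inv_ne_zero.2 (volume_ball_ne_top _ _), ?_⟩
        rw [lintegral_eq_zero_iff' (hω.aemeasurable.restrict.pow_const _)]
        intro h3
        apply hn₀
        filter_upwards [ae_restrict_of_ae_restrict_of_subset (Metric.ball_subset_ball hn') h3]
          with y hy
        rw [Pi.zero_apply, ENNReal.rpow_eq_zero_iff_of_pos hq, ENNReal.ofReal_eq_zero] at hy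
        exact le_antisymm hy (hω.1 y)
    exact ae_restrict_of_ae_restrict_of_subset (Metric.ball_subset_ball hn)
      (ae_pos_of_apqDual_ne_top hp hω h1)
  have := (ae_restrict_iUnion_iff (fun n : ℕ => Metric.ball (0 : EuclideanSpace ℝ (Fin d)) n)
      (fun y => 0 < ω y)).2 key
  rwa [hU, Measure.restrict_univ] at this

/-- An infinite mass, multiplied by the nonzero dual factor, would make the characteristic infinite.
-/
lemma MemApq.powMass_ball_ne_top (hρ : ∀ x, 0 < ρ x) (hp : 1 ≤ p) (hq : 0 < q)
    (hω : MemApq ρ θ p q ω) (x : EuclideanSpace ℝ (Fin d)) {r : ℝ} (hr : 0 < r) :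
    powMass ω q (Metric.ball x r) ≠ ∞ := by
  intro htop
  have h2 := (le_apqConst ρ θ p q ω x hr).trans_lt hω.2.2.2
  unfold powMass at htop
  rw [mean, htop, ENNReal.mul_top (ENNReal.inv_ne_zero.2 (volume_ball_ne_top x r)),
    ENNReal.top_rpow_of_pos (by positivity), ENNReal.mul_top, ENNReal.top_mul] at h2
  · exact lt_irrefl _ h2
  · exact apqDual_ne_zero hp hω x hr
  · rw [ENNReal.ofReal_ne_zero_iff]
    have := hρ x
    positivity

lemma MemApq.powMass_ne_zero (hρ : ∀ x, 0 < ρ x) (hp : 1 ≤ p) (hq : 0 < q)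
    (hω : MemApq ρ θ p q ω) {S : Set (EuclideanSpace ℝ (Fin d))} (hS : volume S ≠ 0) :
    powMass ω q S ≠ 0 := by
  unfold powMass
  rw [Ne, lintegral_eq_zero_iff' (hω.aemeasurable.restrict.pow_const _)]
  intro h
  have hne : (ae (volume.restrict S)).NeBot := by
    rw [ae_neBot, Ne, Measure.restrict_eq_zero]; exact hS
  obtain ⟨y, hy, hy'⟩ := (h.and (ae_restrict_of_ae (hω.ae_pos hρ hp hq))).exists
  rw [Pi.zero_apply, ENNReal.rpow_eq_zero_iff_of_pos hq, ENNReal.ofReal_eq_zero] at hy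
  linarith

lemma mean_eq_lintegral_smul (S : Set (EuclideanSpace ℝ (Fin d)))
    (g : EuclideanSpace ℝ (Fin d) → ℝ≥0∞) :
    mean S g = ∫⁻ x, g x ∂((volume S)⁻¹ • volume.restrict S) := by
  rw [lintegral_smul_measure, mean, smul_eq_mul]

lemma isProbabilityMeasure_inv_smul_restrict {S : Set (EuclideanSpace ℝ (Fin d))}
    (h0 : volume S ≠ 0) (ht : volume S ≠ ∞) :
    IsProbabilityMeasure ((volume S)⁻¹ • volume.restrict S) :=
  ⟨by rw [Measure.smul_apply, Measure.restrict_apply_univ, smul_eq_mul,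
    ENNReal.inv_mul_cancel h0 ht]⟩

lemma lintegral_rpow_rpow_mono {X : Type*} [MeasurableSpace X] {μ : Measure X}
    [IsProbabilityMeasure μ] {h : X → ℝ≥0∞} (hh : AEMeasurable h μ) {a b : ℝ} (ha : 0 < a)
    (hab : a ≤ b) : (∫⁻ x, h x ^ a ∂μ) ^ (1 / a) ≤ (∫⁻ x, h x ^ b ∂μ) ^ (1 / b) := by
  simpa [eLpNorm'] using eLpNorm'_le_eLpNorm'_of_exponent_le ha hab μ hh.aestronglyMeasurable

/-- Hölder for g = (gω)ω⁻¹, then monotonicity of normalised norms from p to q. Positivity of ω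
almost everywhere is what permits the factorisation. -/
lemma mean_le_mul_apqDual (hρ : ∀ x, 0 < ρ x) (hp : 1 ≤ p) (hpq : p < q)
    (hω : MemApq ρ θ p q ω) {g : EuclideanSpace ℝ (Fin d) → ℝ≥0∞} (hg : AEMeasurable g volume)
    (x : EuclideanSpace ℝ (Fin d)) {r : ℝ} (hr : 0 < r) :
    mean (Metric.ball x r) g ≤
      mean (Metric.ball x r) (fun y => (g y * ENNReal.ofReal (ω y)) ^ q) ^ (1 / q) *
        apqDual p ω (Metric.ball x r) := by
  set B := Metric.ball x r
  set μ := (volume B)⁻¹ • volume.restrict B with hμ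
  have : IsProbabilityMeasure μ :=
    isProbabilityMeasure_inv_smul_restrict (volume_ball_ne_zero x hr) (volume_ball_ne_top x r)
  have hac : μ ≪ volume.restrict B := Measure.smul_absolutelyContinuous
  have hac' : μ ≪ volume := hac.trans Measure.restrict_le_self.absolutelyContinuous
  have hgμ : AEMeasurable g μ := hg.mono_ac hac'
  have hωμ : AEMeasurable (fun y => ENNReal.ofReal (ω y)) μ := hω.aemeasurable.mono_ac hac'
  have hpos := hac'.ae_le (hω.ae_pos hρ hp (by linarith))
  set h : EuclideanSpace ℝ (Fin d) → ℝ≥0∞ := fun y => g y * ENNReal.ofReal (ω y) with hh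
  have hhμ : AEMeasurable h μ := hgμ.mul hωμ
  have hgh : ∀ᵐ y ∂μ, g y = h y * (ENNReal.ofReal (ω y))⁻¹ := by
    filter_upwards [hpos] with y hy
    rw [hh, mul_assoc, ENNReal.mul_inv_cancel (ENNReal.ofReal_pos.2 hy).ne'
      ENNReal.ofReal_ne_top, mul_one]
  have hpow : (∫⁻ y, h y ^ p ∂μ) ^ (1 / p) ≤ (∫⁻ y, h y ^ q ∂μ) ^ (1 / q) :=
    lintegral_rpow_rpow_mono hhμ (by linarith) hpq.le
  rw [mean_eq_lintegral_smul, mean_eq_lintegral_smul, ← hμ, lintegral_congr_ae hgh]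
  unfold apqDual
  split_ifs with h1
  · subst h1
    have h2 := hac.ae_le (ae_essInf_le (f := fun x => ENNReal.ofReal (ω x))
      (μ := volume.restrict B))
    calc ∫⁻ y, h y * (ENNReal.ofReal (ω y))⁻¹ ∂μ
        ≤ ∫⁻ y, h y * (essInf (fun x => ENNReal.ofReal (ω x)) (volume.restrict B))⁻¹ ∂μ := by
          refine lintegral_mono_ae ?_
          filter_upwards [h2] with y hy
          gcongr
      _ = (∫⁻ y, h y ∂μ) * (essInf (fun x => ENNReal.ofReal (ω x)) (volume.restrict B))⁻¹ :=
          lintegral_mul_const'' _ hhμ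
      _ ≤ _ := by
          gcongr
          simpa using hpow
  · have hp1 : 1 < p := lt_of_le_of_ne hp (Ne.symm h1)
    have hconj : p.HolderConjugate (p / (p - 1)) := Real.HolderConjugate.conjExponent hp1
    refine (ENNReal.lintegral_mul_le_Lp_mul_Lq μ hconj hhμ hωμ.inv).trans ?_
    rw [mean_eq_lintegral_smul, ← hμ]
    gcongr
    rw [ENNReal.rpow_neg, Pi.inv_apply, ENNReal.inv_rpow]

end Weights

lemma dist_le_of_mem_cube {x y : EuclideanSpace ℝ (Fin d)} {r : ℝ} (hy : y ∈ cube x r) :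
    dist y x ≤ d * (r / 2) := by
  have h1 : ∑ i, dist (y i) (x i) ^ 2 ≤ (∑ i, dist (y i) (x i)) ^ 2 :=
    Finset.sum_sq_le_sq_sum_of_nonneg fun i _ => dist_nonneg
  rw [EuclideanSpace.dist_eq]
  refine (Real.sqrt_le_sqrt h1).trans ?_
  rw [Real.sqrt_sq (Finset.sum_nonneg fun i _ => dist_nonneg)]
  refine (Finset.sum_le_sum fun i _ => (hy i).le).trans ?_
  simp

lemma cube_subset_ball (hd : 0 < d) (x : EuclideanSpace ℝ (Fin d)) {r : ℝ} (hr : 0 < r) :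
    cube x r ⊆ Metric.ball x (d * r) := by
  intro y hy
  rw [Metric.mem_ball]
  have : (0 : ℝ) < d := by exact_mod_cast hd
  refine (dist_le_of_mem_cube hy).trans_lt ?_
  nlinarith [mul_pos this hr]

/-- The constant relating `A_{p,q}` characteristics over balls to averages over cubes. -/
def cubeConst (d : ℕ) (θ : ℝ) : ℝ :=
  (ENNReal.ofReal d ^ d * volume (Metric.ball (0 : EuclideanSpace ℝ (Fin d)) 1)).toReal *
    (d : ℝ) ^ θ

lemma cubeConst_pos (hd : 0 < d) (θ : ℝ) : 0 < cubeConst d θ := by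
  have hd' : (0 : ℝ) < d := by exact_mod_cast hd
  refine mul_pos (ENNReal.toReal_pos ?_ ?_) (by positivity)
  · exact mul_ne_zero (pow_ne_zero _ (ENNReal.ofReal_pos.2 hd').ne')
      (volume_ball_ne_zero _ one_pos)
  · exact ENNReal.mul_ne_top (ENNReal.pow_ne_top ENNReal.ofReal_ne_top) (volume_ball_ne_top _ _)

lemma volume_ball_eq_mul_volume_cube (hd : 0 < d) (x : EuclideanSpace ℝ (Fin d)) {r : ℝ}
    (hr : 0 < r) : volume (Metric.ball x (d * r)) =
      ENNReal.ofReal d ^ d * volume (Metric.ball (0 : EuclideanSpace ℝ (Fin d)) 1) *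
        volume (cube x r) := by
  have : Nonempty (Fin d) := ⟨⟨0, hd⟩⟩
  rw [Measure.addHaar_ball _ _ (by positivity), volume_cube, finrank_euclideanSpace_fin, mul_pow,
    ENNReal.ofReal_mul (by positivity), ENNReal.ofReal_pow (by positivity),
    ENNReal.ofReal_pow hr.le]
  ring

/-- The basic consequence of the `A_{p,q}` condition: averages are controlled by weighted `L^q`
averages. -/
theorem mean_mul_powMass_le {ρ : EuclideanSpace ℝ (Fin d) → ℝ} {θ p q : ℝ}
    {ω : EuclideanSpace ℝ (Fin d) → ℝ} (hd : 0 < d) (hρ : ∀ x, 0 < ρ x) (hθ : 0 ≤ θ) (hp : 1 ≤ p)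
    (hpq : p < q) (hω : MemApq ρ θ p q ω) {g : EuclideanSpace ℝ (Fin d) → ℝ≥0∞}
    (hg : AEMeasurable g volume) (x : EuclideanSpace ℝ (Fin d)) {r : ℝ} (hr : 0 < r) :
    mean (cube x r) g * powMass ω q (cube x r) ^ (1 / q) ≤
      ENNReal.ofReal (cubeConst d θ) * apqConst ρ θ p q ω * ENNReal.ofReal ((1 + r / ρ x) ^ θ) *
        (∫⁻ y in cube x r, g y ^ q * ENNReal.ofReal (ω y) ^ q) ^ (1 / q) := by
  have hd' : (1 : ℝ) ≤ d := by exact_mod_cast hd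
  have hq : 0 < q := by linarith
  have hq' : 0 ≤ 1 / q := by positivity
  set Q := cube x r with hQ
  set B := Metric.ball x (d * r) with hB
  have hdr : 0 < d * r := by positivity
  have hQB : Q ⊆ B := cube_subset_ball hd x hr
  have hQm : MeasurableSet Q := measurableSet_cube x r
  set A := apqConst ρ θ p q ω with hA
  have hB0 : volume B ≠ 0 := volume_ball_ne_zero x hdr
  have hBt : volume B ≠ ∞ := volume_ball_ne_top x _
  -- The characteristic is defined over balls: the cube is placed in B(x, dr) and g is cut off
  -- outside it.
  have h1 := mean_le_mul_apqDual hρ hp hpq hω (hg.indicator hQm) x hdr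
  have h2 := mean_mul_apqDual_le hρ θ p q ω x hdr
  rw [← hB, ← hA] at h2
  rw [← hB] at h1
  have e1 : mean B (Q.indicator g) = (volume B)⁻¹ * ∫⁻ y in Q, g y := by
    rw [mean, setLIntegral_indicator hQm, inter_eq_left.2 hQB]
  have e2 : mean B (fun y => (Q.indicator g y * ENNReal.ofReal (ω y)) ^ q) =
      (volume B)⁻¹ * ∫⁻ y in Q, g y ^ q * ENNReal.ofReal (ω y) ^ q := by
    have : (fun y => (Q.indicator g y * ENNReal.ofReal (ω y)) ^ q) =
        Q.indicator (fun y => g y ^ q * ENNReal.ofReal (ω y) ^ q) := by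
      funext y
      by_cases hy : y ∈ Q
      · simp only [indicator_of_mem hy, ENNReal.mul_rpow_of_nonneg _ _ hq.le]
      · simp only [indicator_of_notMem hy, zero_mul, ENNReal.zero_rpow_of_pos hq]
    rw [this, mean, setLIntegral_indicator hQm, inter_eq_left.2 hQB]
  set X := ∫⁻ y in Q, g y with hX
  set Y := ∫⁻ y in Q, g y ^ q * ENNReal.ofReal (ω y) ^ q with hY
  set a := ENNReal.ofReal ((1 + d * r / ρ x) ^ θ) with ha
  set b := ((volume B)⁻¹) ^ (1 / q) with hb
  have hb0 : b ≠ 0 := by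
    rw [hb, Ne, ENNReal.rpow_eq_zero_iff_of_pos (by positivity)]
    exact ENNReal.inv_ne_zero.2 hBt
  have hbt : b ≠ ∞ := ENNReal.rpow_ne_top_of_nonneg hq' (ENNReal.inv_ne_top.2 hB0)
  rw [e1, e2, ENNReal.mul_rpow_of_nonneg _ _ hq'] at h1
  rw [mean, ENNReal.mul_rpow_of_nonneg _ _ hq'] at h2
  -- The factor b = |B|^{-1/q} completes the mean of ω^q over B; it is finite and nonzero and
  -- cancels again.
  have h3 : b * ((volume B)⁻¹ * X * powMass ω q B ^ (1 / q)) ≤ b * (Y ^ (1 / q) * (A * a)) := by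
    calc b * ((volume B)⁻¹ * X * powMass ω q B ^ (1 / q))
        = ((volume B)⁻¹ * X) * (b * powMass ω q B ^ (1 / q)) := by ring
      _ ≤ (b * Y ^ (1 / q) * apqDual p ω B) * (b * powMass ω q B ^ (1 / q)) := by gcongr
      _ = b * Y ^ (1 / q) * (b * powMass ω q B ^ (1 / q) * apqDual p ω B) := by ring
      _ ≤ b * Y ^ (1 / q) * (A * a) := by exact mul_le_mul_right h2 _
      _ = _ := by ring
  have h4 := (ENNReal.mul_le_mul_iff_right hb0 hbt).1 h3
  set κ := ENNReal.ofReal d ^ d * volume (Metric.ball (0 : EuclideanSpace ℝ (Fin d)) 1) with hκ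
  have hκt : κ ≠ ∞ :=
    ENNReal.mul_ne_top (ENNReal.pow_ne_top ENNReal.ofReal_ne_top) (volume_ball_ne_top _ _)
  have hvol : volume B = κ * volume Q := volume_ball_eq_mul_volume_cube hd x hr
  have h5 : (volume Q)⁻¹ = κ * (volume B)⁻¹ := by
    have hQ0 := (volume_cube_pos x hr).ne'
    have hκ0 : κ ≠ 0 := by
      intro h0; rw [h0, zero_mul] at hvol; exact hB0 hvol
    rw [hvol, ENNReal.mul_inv (Or.inl hκ0) (Or.inl hκt), ← mul_assoc,
      ENNReal.mul_inv_cancel hκ0 hκt, one_mul]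
  -- Uses 1 + dr/ρ ≤ d(1 + r/ρ), valid because d ≥ 1.
  have h6 : a ≤ ENNReal.ofReal ((d : ℝ) ^ θ) * ENNReal.ofReal ((1 + r / ρ x) ^ θ) := by
    have := hρ x
    rw [← ENNReal.ofReal_mul (by positivity), ← Real.mul_rpow (by positivity) (by positivity), ha]
    refine ENNReal.ofReal_le_ofReal (Real.rpow_le_rpow (by positivity) ?_ hθ)
    rw [mul_add, mul_one, mul_div_assoc]
    gcongr
  have h7 : ENNReal.ofReal (cubeConst d θ) = κ * ENNReal.ofReal ((d : ℝ) ^ θ) := by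
    rw [cubeConst, ENNReal.ofReal_mul ENNReal.toReal_nonneg, ENNReal.ofReal_toReal hκt]
  calc mean Q g * powMass ω q Q ^ (1 / q)
      = κ * ((volume B)⁻¹ * X * powMass ω q Q ^ (1 / q)) := by rw [mean, h5]; ring
    _ ≤ κ * ((volume B)⁻¹ * X * powMass ω q B ^ (1 / q)) := by
        gcongr
        exact lintegral_mono_set hQB
    _ ≤ κ * (Y ^ (1 / q) * (A * a)) := by gcongr
    _ ≤ κ * (Y ^ (1 / q) * (A * (ENNReal.ofReal ((d : ℝ) ^ θ) *
          ENNReal.ofReal ((1 + r / ρ x) ^ θ)))) := by gcongr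
    _ = _ := by rw [h7]; ring

end

/-! ### Slow variation on cubes and the comparison (b). -/

section

variable {d : ℕ} {ρ : EuclideanSpace ℝ (Fin d) → ℝ} {C₀ N₀ θ p q : ℝ}
  {ω : EuclideanSpace ℝ (Fin d) → ℝ}

lemma side_le_of_cube_subset (hd : 0 < d) {c x₀ : EuclideanSpace ℝ (Fin d)} {t r : ℝ} (hr : 0 < r)
    (h : cube c t ⊆ cube x₀ r) : t ≤ r := by
  have h1 := measure_mono (μ := volume) h
  rw [volume_cube, volume_cube] at h1
  have h2 : ENNReal.ofReal t ≤ ENNReal.ofReal r := by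
    by_contra! hlt
    exact absurd h1 (not_le.2 (ENNReal.pow_right_strictMono hd.ne' hlt))
  exact (ENNReal.ofReal_le_ofReal_iff hr.le).1 h2

lemma SlowVariation.le_mul_of_mem_cube (h : SlowVariation ρ C₀ N₀) (hρ : ∀ x, 0 < ρ x) (hd : 0 < d)
    {x₀ x : EuclideanSpace ℝ (Fin d)} {r : ℝ} (hr : 0 < r) (hx : x ∈ cube x₀ r) :
    ρ x₀ ≤ C₀ * (d : ℝ) ^ N₀ * (1 + r / ρ x₀) ^ N₀ * ρ x := by
  obtain ⟨hC, hN, h⟩ := h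
  have hd' : (1 : ℝ) ≤ d := by exact_mod_cast hd
  have h0 := hρ x₀
  have h1 := (h x₀ x).1
  have h2 : 1 + dist x₀ x / ρ x₀ ≤ d * (1 + r / ρ x₀) := by
    have h3 := dist_le_of_mem_cube hx
    rw [dist_comm] at h3
    have h4 : dist x₀ x / ρ x₀ ≤ d * (r / ρ x₀) := by
      rw [← mul_div_assoc]
      gcongr
      exact h3.trans (by gcongr; linarith)
    rw [mul_add, mul_one]; linarith
  have h5 : (0 : ℝ) < 1 + dist x₀ x / ρ x₀ := by positivity
  have h6 : (1 + dist x₀ x / ρ x₀) ^ N₀ ≤ (d : ℝ) ^ N₀ * (1 + r / ρ x₀) ^ N₀ := by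
    rw [← Real.mul_rpow (by positivity) (by positivity)]
    exact Real.rpow_le_rpow h5.le h2 hN.le
  rw [Real.rpow_neg h5.le, one_div, ← mul_inv, le_div_iff₀ h0, inv_mul_le_iff₀ (by positivity)] at h1
  calc ρ x₀ ≤ C₀ * (1 + dist x₀ x / ρ x₀) ^ N₀ * ρ x := h1
    _ ≤ C₀ * ((d : ℝ) ^ N₀ * (1 + r / ρ x₀) ^ N₀) * ρ x := by
        have := hρ x
        gcongr
    _ = _ := by ring

lemma SlowVariation.one_le_const (h : SlowVariation ρ C₀ N₀) (hd : 0 < d) :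
    1 ≤ C₀ * (d : ℝ) ^ N₀ :=
  one_le_mul_of_one_le_of_one_le h.1
    (Real.one_le_rpow (by exact_mod_cast hd) h.2.1.le)

/-- Source of the exponent N₀ + 1: passing from ρ(x) to ρ(x₀) costs N₀ powers of 1 + r/ρ(x₀), and
r/ρ(x₀) itself costs one more. -/
lemma SlowVariation.one_add_div_le (h : SlowVariation ρ C₀ N₀) (hρ : ∀ x, 0 < ρ x) (hd : 0 < d)
    {x₀ x : EuclideanSpace ℝ (Fin d)} {r t : ℝ} (hr : 0 < r) (htr : t ≤ r)
    (hx : x ∈ cube x₀ r) :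
    1 + t / ρ x ≤ C₀ * (d : ℝ) ^ N₀ * (1 + r / ρ x₀) ^ (N₀ + 1) := by
  have h1 := h.le_mul_of_mem_cube hρ hd hr hx
  have hC := h.one_le_const hd
  have h0 := hρ x₀
  have hx0 := hρ x
  set C := C₀ * (d : ℝ) ^ N₀
  have hL : 1 ≤ 1 + r / ρ x₀ := by linarith [div_pos hr h0]
  have hLN : 1 ≤ (1 + r / ρ x₀) ^ N₀ := Real.one_le_rpow hL h.2.1.le
  have h2 : t / ρ x ≤ C * (1 + r / ρ x₀) ^ N₀ * (r / ρ x₀) := by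
    rw [div_le_iff₀ hx0]
    have h3 : r * ρ x₀ ≤ r * (C * (1 + r / ρ x₀) ^ N₀ * ρ x) := by gcongr
    have h4 : r ≤ r * (C * (1 + r / ρ x₀) ^ N₀ * ρ x) / ρ x₀ := (le_div_iff₀ h0).2 h3
    refine htr.trans (h4.trans (le_of_eq ?_))
    ring
  rw [Real.rpow_add_one (by positivity)]
  nlinarith [mul_le_mul hC hLN zero_le_one (by linarith)]

lemma powMass_eq_withDensity (ω : EuclideanSpace ℝ (Fin d) → ℝ) (q : ℝ)
    {S : Set (EuclideanSpace ℝ (Fin d))} (hS : MeasurableSet S) :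
    powMass ω q S = volume.withDensity (fun x => ENNReal.ofReal (ω x) ^ q) S := by
  rw [powMass, withDensity_apply _ hS]

lemma MemApq.powMass_cube_ne_top (hd : 0 < d) (hρ : ∀ x, 0 < ρ x) (hp : 1 ≤ p) (hq : 0 < q)
    (hω : MemApq ρ θ p q ω) (x : EuclideanSpace ℝ (Fin d)) {r : ℝ} (hr : 0 < r) :
    powMass ω q (cube x r) ≠ ∞ := by
  have hd' : (0 : ℝ) < d := by exact_mod_cast hd
  exact ((lintegral_mono_set (cube_subset_ball hd x hr)).trans_lt
    (hω.powMass_ball_ne_top hρ hp hq x (mul_pos hd' hr)).lt_top).ne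

/-- On cubes of side at most the critical radius, a set occupying at most half of the cube carries
at most a fixed proportion of the weighted mass. -/
lemma powMass_le_of_half (hd : 0 < d) (hρ : ∀ x, 0 < ρ x) (hθ : 0 ≤ θ) (hp : 1 ≤ p)
    (hpq : p < q) (hω : MemApq ρ θ p q ω) {M : ℝ} (hM0 : 0 ≤ M)
    (hM : apqConst ρ θ p q ω ≤ ENNReal.ofReal M) {B : ℝ} (hB : 0 < B)
    (hB' : (2 * (cubeConst d θ * M * 2 ^ θ)) ^ q ≤ B)
    (c : EuclideanSpace ℝ (Fin d)) {t : ℝ} (ht : 0 < t) (htρ : t ≤ ρ c)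
    {F : Set (EuclideanSpace ℝ (Fin d))} (hF : MeasurableSet F) (hFc : F ⊆ cube c t)
    (hF2 : volume F ≤ 2⁻¹ * volume (cube c t)) :
    powMass ω q F ≤ ENNReal.ofReal (1 - B⁻¹) * powMass ω q (cube c t) := by
  have hq : 0 < q := by linarith
  set Q := cube c t with hQ
  have hQm : MeasurableSet Q := measurableSet_cube c t
  have hQ0 : volume Q ≠ 0 := (volume_cube_pos c ht).ne'
  have hQt : volume Q ≠ ∞ := volume_cube_ne_top c t
  have hwt := hω.powMass_cube_ne_top hd hρ hp hq c ht
  have hcd := cubeConst_pos hd θ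
  set G := Q \ F with hG
  have hGm : MeasurableSet G := hQm.diff hF
  have hsum : powMass ω q F + powMass ω q G = powMass ω q Q := by
    rw [powMass_eq_withDensity ω q hF, powMass_eq_withDensity ω q hGm,
      powMass_eq_withDensity ω q hQm, hG]
    conv_rhs => rw [← measure_inter_add_sdiff Q hF, inter_eq_right.2 hFc]
  -- Tested on the complement G of F, which fills at least half of the cube; this bounds ω^q(G) from
  -- below.
  have key := mean_mul_powMass_le hd hρ hθ hp hpq hω
    (g := G.indicator 1) (aemeasurable_one.indicator hGm) c ht
  rw [← hQ] at key
  have e1 : mean Q (G.indicator 1) = (volume Q)⁻¹ * volume G := by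
    rw [mean, lintegral_indicator_one hGm, Measure.restrict_apply hGm,
      inter_eq_left.2 sdiff_subset]
  have e2 : ∫⁻ y in Q, (G.indicator 1 y : ℝ≥0∞) ^ q * ENNReal.ofReal (ω y) ^ q = powMass ω q G := by
    have : (fun y => (G.indicator 1 y : ℝ≥0∞) ^ q * ENNReal.ofReal (ω y) ^ q) =
        G.indicator (fun y => ENNReal.ofReal (ω y) ^ q) := by
      funext y
      by_cases hy : y ∈ G
      · simp [indicator_of_mem hy]
      · simp [indicator_of_notMem hy, ENNReal.zero_rpow_of_pos hq]
    rw [this, setLIntegral_indicator hGm, inter_eq_left.2 sdiff_subset, powMass]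
  have e3 : (2 : ℝ≥0∞)⁻¹ ≤ (volume Q)⁻¹ * volume G := by
    have h1 : volume Q ≤ volume F + volume G := by
      rw [hG]
      refine (measure_mono ?_).trans (measure_union_le F (Q \ F))
      intro y hy
      by_cases hyF : y ∈ F
      · exact Or.inl hyF
      · exact Or.inr ⟨hy, hyF⟩
    have h2 : 2⁻¹ * volume Q + 2⁻¹ * volume Q ≤ 2⁻¹ * volume Q + volume G := by
      rw [← add_mul, ENNReal.inv_two_add_inv_two, one_mul]
      exact h1.trans (by gcongr)
    have h3 := (ENNReal.add_le_add_iff_left (ENNReal.mul_ne_top (by simp) hQt)).1 h2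
    calc (2 : ℝ≥0∞)⁻¹ = (volume Q)⁻¹ * (2⁻¹ * volume Q) := by
          rw [mul_left_comm, ENNReal.inv_mul_cancel hQ0 hQt, mul_one]
      _ ≤ _ := by gcongr
  rw [e1, e2] at key
  have e4 : ENNReal.ofReal (cubeConst d θ) * apqConst ρ θ p q ω *
      ENNReal.ofReal ((1 + t / ρ c) ^ θ) ≤ ENNReal.ofReal (cubeConst d θ * M * 2 ^ θ) := by
    have hρc := hρ c
    rw [ENNReal.ofReal_mul (by positivity), ENNReal.ofReal_mul hcd.le]
    gcongr
    have : t / ρ c ≤ 1 := (div_le_one hρc).2 htρ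
    linarith
  have e5 : powMass ω q Q ^ (1 / q) ≤
      ENNReal.ofReal (2 * (cubeConst d θ * M * 2 ^ θ)) * powMass ω q G ^ (1 / q) := by
    calc powMass ω q Q ^ (1 / q) = 2 * (2⁻¹ * powMass ω q Q ^ (1 / q)) := by
          rw [← mul_assoc, ENNReal.mul_inv_cancel (by simp) (by simp), one_mul]
      _ ≤ 2 * ((volume Q)⁻¹ * volume G * powMass ω q Q ^ (1 / q)) := by gcongr
      _ ≤ 2 * (ENNReal.ofReal (cubeConst d θ * M * 2 ^ θ) * powMass ω q G ^ (1 / q)) := by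
          exact mul_le_mul_right (key.trans (mul_le_mul_left e4 _)) _
      _ = _ := by
          rw [ENNReal.ofReal_mul (p := 2) (by norm_num), ENNReal.ofReal_ofNat]; ring
  have e6 : powMass ω q Q ≤ ENNReal.ofReal B * powMass ω q G := by
    have h1 := ENNReal.rpow_le_rpow e5 hq.le
    rw [ENNReal.mul_rpow_of_nonneg _ _ hq.le, ← ENNReal.rpow_mul, ← ENNReal.rpow_mul,
      one_div_mul_cancel hq.ne', ENNReal.rpow_one, ENNReal.rpow_one,
      ENNReal.ofReal_rpow_of_nonneg (by positivity) hq.le] at h1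
    exact h1.trans (by gcongr)
  have hBi : ENNReal.ofReal B⁻¹ * ENNReal.ofReal B = 1 := by
    rw [← ENNReal.ofReal_mul (by positivity), inv_mul_cancel₀ hB.ne', ENNReal.ofReal_one]
  have e7 : ENNReal.ofReal B⁻¹ * powMass ω q Q ≤ powMass ω q G := by
    calc _ ≤ ENNReal.ofReal B⁻¹ * (ENNReal.ofReal B * powMass ω q G) := by gcongr
      _ = _ := by rw [← mul_assoc, hBi, one_mul]
  refine (ENNReal.add_le_add_iff_right
    (ENNReal.mul_ne_top (ENNReal.ofReal_ne_top (r := B⁻¹)) hwt)).1 ?_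
  calc powMass ω q F + ENNReal.ofReal B⁻¹ * powMass ω q Q
      ≤ powMass ω q F + powMass ω q G := by gcongr
    _ = powMass ω q Q := hsum
    _ = ENNReal.ofReal 1 * powMass ω q Q := by simp
    _ ≤ ENNReal.ofReal ((1 - B⁻¹) + B⁻¹) * powMass ω q Q := by gcongr; linarith
    _ ≤ (ENNReal.ofReal (1 - B⁻¹) + ENNReal.ofReal B⁻¹) * powMass ω q Q := by
        gcongr; exact ENNReal.ofReal_add_le
    _ = _ := by rw [add_mul]

/-- Weights in `A_{p,q}^{ρ,θ}` satisfy the `A_∞`-type comparison, uniformly for bounded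
characteristic. -/
theorem exists_massComparison (hd : 0 < d) (hρ : ∀ x, 0 < ρ x) (hsv : SlowVariation ρ C₀ N₀)
    (hθ : 0 ≤ θ) (hp : 1 ≤ p) (hpq : p < q) (M : ℝ≥0) :
    ∃ δ η K : ℝ, 0 < δ ∧ δ < 1 ∧ 1 < η ∧ 0 < K ∧ ∀ ω : EuclideanSpace ℝ (Fin d) → ℝ,
      MemApq ρ θ p q ω → apqConst ρ θ p q ω ≤ (M : ℝ≥0∞) → MassComparison ρ δ η K ω q := by
  have hq : 0 < q := by linarith
  have hcd := cubeConst_pos hd θ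
  -- The added 1 keeps B positive when M = 0.
  set B : ℝ := (2 * (cubeConst d θ * M * 2 ^ θ)) ^ q + 1 with hBdef
  have hB : 0 < B := by positivity
  obtain ⟨δ, hδ0, hδ1, hδ⟩ := exists_rpow_ge (β := 1 - B⁻¹) (by linarith [inv_pos.2 hB])
    (a := ((2 : ℝ) ^ (d + 1))⁻¹) (by positivity)
  set C := C₀ * (d : ℝ) ^ N₀ with hC
  have hC1 : 1 ≤ C := hsv.one_le_const hd
  have hN := hsv.2.1
  -- The exponent (N₀ + 1)dδ comes from (2^{nd})^δ with 2^n of size C L^{N₀+1}; the maximum with 2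
  -- only secures η > 1.
  refine ⟨δ, max 2 ((N₀ + 1) * d * δ), 2 ^ (d + 1) * ((2 * C) ^ d) ^ δ, hδ0, hδ1,
    lt_max_of_lt_left (by norm_num), by positivity, ?_⟩
  intro ω hω hωM x₀ r hr S hS hSQ
  set L := 1 + r / ρ x₀ with hL
  have h0 := hρ x₀
  have hL1 : 1 ≤ L := by linarith [div_pos hr h0]
  set X := C * L ^ (N₀ + 1) with hX
  have hX1 : 1 ≤ X := one_le_mul_of_one_le_of_one_le hC1 (Real.one_le_rpow hL1 (by linarith))
  -- With n = m + 1, X < 2^n makes the cells small enough, and 2^n ≤ 2X keeps their number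
  -- polynomial in L.
  obtain ⟨m, hm1, hm2⟩ := exists_nat_pow_near hX1 (by norm_num : (1 : ℝ) < 2)
  set n := m + 1 with hn
  have hn2 : (2 : ℝ) ^ n ≤ 2 * X := by rw [hn, pow_succ']; linarith
  set Q := cube x₀ r with hQ
  set ν := volume.withDensity (fun x => ENNReal.ofReal (ω x) ^ q) with hν
  have hνac : ν ≪ volume := withDensity_absolutelyContinuous _ _
  have hQm : MeasurableSet Q := measurableSet_cube x₀ r
  set D := dyadicCell x₀ r n with hD
  have hDm : ∀ k, MeasurableSet (D k) := measurableSet_dyadicCell x₀ r n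
  have hDd : Pairwise (fun k l => Disjoint (D k) (D l)) := by
    intro k l hkl
    rw [Set.disjoint_left]
    intro x hx hx'
    exact hkl ((hx : dyadicIndex x₀ r n x = k).symm.trans hx')
  have hcover : ∀ T : Set (EuclideanSpace ℝ (Fin d)), MeasurableSet T →
      ν T = ∑' k, ν (D k ∩ T) := by
    intro T hT
    have : T = ⋃ k, D k ∩ T := by
      ext x
      simp only [mem_iUnion, mem_inter_iff, exists_and_right]
      exact ⟨fun h => ⟨⟨_, rfl⟩, h⟩, fun h => h.2⟩
    conv_lhs => rw [this]
    rw [measure_iUnion]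
    · exact fun k l hkl => (hDd hkl).mono inter_subset_left inter_subset_left
    · exact fun k => (hDm k).inter hT
  set κ : ℝ≥0∞ := 2 ^ (d + 1) * (2 ^ (n * d) * (volume S / volume Q)) ^ δ with hκ
  have hcell : ∀ k, ν (D k ∩ S) ≤ κ * ν (D k ∩ Q) := by
    intro k
    rcases (D k ∩ S).eq_empty_or_nonempty with he | hne
    · rw [he, measure_empty]; exact zero_le
    have hsubQ : cube (dyadicCenter x₀ r n k) (r / 2 ^ n) ⊆ Q :=
      cube_dyadicCenter_subset hr (hne.mono (inter_subset_inter_right _ hSQ))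
    have hh : 0 < r / 2 ^ n := by positivity
    set P := cube (dyadicCenter x₀ r n k) (r / 2 ^ n) with hP
    have hPD : D k =ᵐ[volume] P := dyadicCell_ae_eq x₀ hr n k
    have hvolP : volume Q = 2 ^ (n * d) * volume P := by
      have := volume_dyadicCell_eq_two_pow_mul x₀ hr 0 n 0 k
      rw [zero_add, measure_congr (dyadicCell_ae_eq x₀ hr 0 0), dyadicCenter_zero] at this
      rw [← measure_congr hPD]
      simpa using this
    have h1 := measure_le_rpow_mul_of_half hνac hh (β := ENNReal.ofReal (1 - B⁻¹)) hδ0 hδ1 ?_ ?_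
      (hS.inter (measurableSet_cube (dyadicCenter x₀ r n k) (r / 2 ^ n))) inter_subset_right
    · rw [← hP] at h1
      calc ν (D k ∩ S) = ν (S ∩ P) := by
            rw [inter_comm]
            exact measure_congr ((ae_eq_refl S).inter (hνac.ae_eq hPD))
        _ ≤ _ := h1
        _ ≤ κ * ν P := by
            refine mul_le_mul_left (mul_le_mul_right (ENNReal.rpow_le_rpow ?_ hδ0.le) _) _
            calc volume (S ∩ P) / volume P ≤ volume S / volume P := by
                  gcongr; exact inter_subset_left
              _ = 2 ^ (n * d) * (volume S / volume Q) := by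
                  rw [hvolP, ENNReal.div_eq_inv_mul, ENNReal.div_eq_inv_mul,
                    ENNReal.mul_inv (Or.inl (by simp)) (Or.inl (by simp)), ← mul_assoc,
                    ← mul_assoc, ENNReal.mul_inv_cancel (by simp) (by simp), one_mul]
        _ ≤ κ * ν (D k ∩ Q) := by
            gcongr
            exact subset_inter (cube_subset_dyadicCell x₀ hr n k) hsubQ
    · have h2 := ENNReal.ofReal_le_ofReal hδ
      rwa [← ENNReal.ofReal_rpow_of_pos (by positivity), ENNReal.ofReal_inv_of_pos (by positivity),
        ENNReal.ofReal_pow (by norm_num), ENNReal.ofReal_ofNat] at h2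
    · intro c t ht hcP F hF hFc hF2
      rw [← powMass_eq_withDensity ω q hF, ← powMass_eq_withDensity ω q (measurableSet_cube c t)]
      refine powMass_le_of_half hd hρ hθ hp hpq hω M.coe_nonneg (by simpa using hωM) hB
        (by rw [hBdef]; linarith) c ht ?_ hF hFc hF2
      -- Slow variation gives r ≤ Xρ(c) for every c in Q, so t ≤ r/2^n ≤ ρ(c) and the estimate for
      -- small cubes applies.
      have h3 := side_le_of_cube_subset hd hh hcP
      have h4 := hsv.le_mul_of_mem_cube hρ hd hr (hsubQ (hcP (mem_cube_self c ht)))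
      rw [← hC, ← hL] at h4
      have h5 : r ≤ ρ x₀ * L := by rw [hL]; field_simp; linarith
      have h6 : r ≤ 2 ^ n * ρ c := by
        calc r ≤ ρ x₀ * L := h5
          _ ≤ C * L ^ N₀ * ρ c * L := by gcongr
          _ = X * ρ c := by rw [hX, Real.rpow_add_one (by positivity)]; ring
          _ ≤ _ := by have := hρ c; gcongr
      refine h3.trans ?_
      rw [div_le_iff₀ (by positivity)]; linarith
  have hfin : ν S ≤ κ * ν Q := by
    rw [hcover S hS, hcover Q hQm, ← ENNReal.tsum_mul_left]
    exact ENNReal.tsum_le_tsum hcell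
  rw [powMass_eq_withDensity ω q hS, powMass_eq_withDensity ω q hQm]
  refine hfin.trans ?_
  gcongr
  have h7 : ((2 : ℝ≥0∞) ^ (n * d)) ^ δ ≤ ENNReal.ofReal (((2 * C) ^ d) ^ δ) *
      ENNReal.ofReal (L ^ max 2 ((N₀ + 1) * d * δ)) := by
    have h8 : (2 : ℝ≥0∞) ^ (n * d) = ENNReal.ofReal (((2 : ℝ) ^ n) ^ d) := by
      rw [← pow_mul, ENNReal.ofReal_pow (by norm_num), ENNReal.ofReal_ofNat]
    rw [h8, ENNReal.ofReal_rpow_of_pos (by positivity), ← ENNReal.ofReal_mul (by positivity)]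
    apply ENNReal.ofReal_le_ofReal
    calc (((2 : ℝ) ^ n) ^ d) ^ δ ≤ ((2 * X) ^ d) ^ δ := by gcongr
      _ = ((2 * C) ^ d) ^ δ * L ^ ((N₀ + 1) * d * δ) := by
          rw [hX, ← mul_assoc, mul_pow, Real.mul_rpow (by positivity) (by positivity),
            Real.rpow_mul (by positivity), Real.rpow_mul (by positivity), Real.rpow_natCast]
      _ ≤ _ := by
          gcongr
          exact le_max_right _ _
  rw [hκ, ENNReal.mul_rpow_of_nonneg _ _ hδ0.le, ENNReal.ofReal_mul (by positivity),
    ENNReal.ofReal_pow (by norm_num), ENNReal.ofReal_ofNat]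
  calc (2 : ℝ≥0∞) ^ (d + 1) * (((2 : ℝ≥0∞) ^ (n * d)) ^ δ * (volume S / volume Q) ^ δ)
      ≤ 2 ^ (d + 1) * ((ENNReal.ofReal (((2 * C) ^ d) ^ δ) *
      ENNReal.ofReal (L ^ max 2 ((N₀ + 1) * d * δ))) * (volume S / volume Q) ^ δ) := by gcongr
    _ = _ := by ring

end

/-! ### Weighted lower oscillation: the two directions of the characterization. -/

section

variable {d : ℕ} {ρ : EuclideanSpace ℝ (Fin d) → ℝ} {C₀ N₀ θ p q : ℝ}
  {ω f : EuclideanSpace ℝ (Fin d) → ℝ}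

lemma coe_sub_coe_toENNReal (a b : ℝ) : ((a : EReal) - (b : EReal)).toENNReal =
    ENNReal.ofReal (a - b) := by
  rw [← EReal.coe_sub, EReal.toENNReal_of_ne_top (EReal.coe_ne_top _), EReal.toReal_coe]

/-- An essential infimum of -∞ would make the oscillation identically ∞, and +∞ is impossible for a
real function on a set of positive measure. Hence a finite mean makes the essential infimum real. -/
lemma exists_real_essInf {S : Set (EuclideanSpace ℝ (Fin d))} (h0 : volume S ≠ 0)
    (ht : volume S ≠ ∞) (h : mean S (lowerOsc f S) ≠ ∞) :
    ∃ m : ℝ, (∀ᵐ x ∂volume.restrict S, m ≤ f x) ∧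
      ∀ x, lowerOsc f S x = ENNReal.ofReal (f x - m) := by
  have hne : (ae (volume.restrict S)).NeBot := by
    rw [ae_neBot, Ne, Measure.restrict_eq_zero]; exact h0
  have hae := ae_essInf_le (f := fun y => (f y : EReal)) (μ := volume.restrict S)
  have hlo : ∀ x, lowerOsc f S x =
    ((f x : EReal) - essInf (fun y => (f y : EReal)) (volume.restrict S)).toENNReal := fun x => rfl
  generalize essInf (fun y => (f y : EReal)) (volume.restrict S) = e at hae hlo
  induction e with
  | bot =>
    exfalso
    have : mean S (lowerOsc f S) = ∞ := by
      have h1 : lowerOsc f S = fun _ => ∞ := by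
        funext x
        rw [hlo, EReal.coe_sub_bot, EReal.toENNReal_top]
      rw [h1, mean, setLIntegral_const, ENNReal.top_mul h0,
        ENNReal.mul_top (ENNReal.inv_ne_zero.2 ht)]
    exact h this
  | top =>
    exfalso
    obtain ⟨y, hy⟩ := hae.exists
    exact EReal.coe_ne_top _ (top_le_iff.1 hy)
  | coe m =>
    refine ⟨m, ?_, fun x => by rw [hlo, coe_sub_coe_toENNReal]⟩
    filter_upwards [hae] with y hy
    exact EReal.coe_le_coe_iff.1 hy

lemma aemeasurable_lowerOsc (hf : AEMeasurable f volume) (S : Set (EuclideanSpace ℝ (Fin d))) :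
    AEMeasurable (lowerOsc f S) volume := by
  have hlo : lowerOsc f S = fun x =>
    ((f x : EReal) - essInf (fun y => (f y : EReal)) (volume.restrict S)).toENNReal := rfl
  rw [hlo]
  generalize essInf (fun y => (f y : EReal)) (volume.restrict S) = e
  induction e with
  | bot => simp
  | top => simp
  | coe m =>
    simp only [coe_sub_coe_toENNReal]
    exact (hf.sub_const m).ennreal_ofReal

lemma mean_lowerOsc_le_bloConst (hρ : ∀ x, 0 < ρ x) (θ : ℝ) (f : EuclideanSpace ℝ (Fin d) → ℝ)
    (x : EuclideanSpace ℝ (Fin d)) {r : ℝ} (hr : 0 < r) :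
    mean (cube x r) (lowerOsc f (cube x r)) ≤
      ENNReal.ofReal ((1 + r / ρ x) ^ θ) * bloConst ρ θ f := by
  have hL : 0 < 1 + r / ρ x := by have := hρ x; positivity
  have h : ENNReal.ofReal ((1 + r / ρ x) ^ (-θ)) * mean (cube x r) (lowerOsc f (cube x r)) ≤
      bloConst ρ θ f := le_iSup_of_le x (le_iSup_of_le r (le_iSup_of_le hr le_rfl))
  have h1 : ENNReal.ofReal ((1 + r / ρ x) ^ θ) * ENNReal.ofReal ((1 + r / ρ x) ^ (-θ)) = 1 := by
    rw [← ENNReal.ofReal_mul (by positivity), ← Real.rpow_add hL]; simp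
  calc _ = ENNReal.ofReal ((1 + r / ρ x) ^ θ) * (ENNReal.ofReal ((1 + r / ρ x) ^ (-θ)) *
        mean (cube x r) (lowerOsc f (cube x r))) := by rw [← mul_assoc, h1, one_mul]
    _ ≤ _ := by gcongr

lemma lintegral_eq_volume_mul_mean {S : Set (EuclideanSpace ℝ (Fin d))} (h0 : volume S ≠ 0)
    (ht : volume S ≠ ∞) (g : EuclideanSpace ℝ (Fin d) → ℝ≥0∞) :
    ∫⁻ x in S, g x = volume S * mean S g := by
  rw [mean, ← mul_assoc, ENNReal.mul_inv_cancel h0 ht, one_mul]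

/-- A discrete layer-cake bound: where h > 0, the single level k = ⌊h/l⌋ already dominates h^q. -/
lemma lintegral_ofReal_rpow_le_tsum {X : Type*} [MeasurableSpace X] (μ : Measure X) {h : X → ℝ}
    (hh : Measurable h) {l q : ℝ} (hl : 0 < l) (hq : 0 < q) :
    ∫⁻ x, ENNReal.ofReal (h x) ^ q ∂μ ≤
      ∑' k : ℕ, ENNReal.ofReal (((k + 1) * l) ^ q) * μ {x | k * l ≤ h x} := by
  have hm : ∀ k : ℕ, MeasurableSet {x | k * l ≤ h x} :=
    fun k => measurableSet_le measurable_const hh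
  calc ∫⁻ x, ENNReal.ofReal (h x) ^ q ∂μ
      ≤ ∫⁻ x, ∑' k : ℕ, {x | k * l ≤ h x}.indicator
          (fun _ => ENNReal.ofReal (((k + 1) * l) ^ q)) x ∂μ := by
        refine lintegral_mono fun x => ?_
        rcases le_or_gt (h x) 0 with h0 | h0
        · rw [ENNReal.ofReal_of_nonpos h0, ENNReal.zero_rpow_of_pos hq]; exact zero_le
        · refine le_trans ?_ (ENNReal.le_tsum ⌊h x / l⌋₊)
          have h1 : (⌊h x / l⌋₊ : ℝ) * l ≤ h x := by
            rw [← le_div_iff₀ hl]; exact Nat.floor_le (by positivity)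
          have h2 : h x ≤ (⌊h x / l⌋₊ + 1) * l := by
            rw [← div_le_iff₀ hl]; exact (Nat.lt_floor_add_one _).le
          rw [indicator_of_mem (by exact h1), ENNReal.ofReal_rpow_of_pos h0]
          exact ENNReal.ofReal_le_ofReal (Real.rpow_le_rpow h0.le h2 hq.le)
    _ = _ := by
        rw [lintegral_tsum fun k => (measurable_const.indicator (hm k)).aemeasurable]
        refine tsum_congr fun k => ?_
        rw [lintegral_indicator (hm k), setLIntegral_const]

lemma summable_rpow_mul_rpow (q : ℝ) {δ : ℝ} (hδ : 0 < δ) :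
    Summable fun k : ℕ => ((k : ℝ) + 1) ^ q * ((1 / 2 : ℝ) ^ δ) ^ k := by
  have ha : (1 / 2 : ℝ) ^ δ < 1 := Real.rpow_lt_one (by norm_num) (by norm_num) hδ
  have ha0 : 0 < (1 / 2 : ℝ) ^ δ := by positivity
  set a := (1 / 2 : ℝ) ^ δ
  have h1 := (summable_nat_add_iff 1).2 (summable_pow_mul_geometric_of_norm_lt_one ⌈q⌉₊
    (r := a) (by rwa [Real.norm_of_nonneg ha0.le]))
  refine Summable.of_nonneg_of_le (fun k => by positivity) (fun k => ?_) (h1.mul_left a⁻¹)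
  have h2 : ((k : ℝ) + 1) ^ q ≤ ((k : ℝ) + 1) ^ ⌈q⌉₊ := by
    rw [← Real.rpow_natCast]
    exact Real.rpow_le_rpow_of_exponent_le (by linarith [k.cast_nonneg (α := ℝ)]) (Nat.le_ceil q)
  calc _ ≤ ((k : ℝ) + 1) ^ ⌈q⌉₊ * a ^ k := by gcongr
    _ = _ := by push_cast; rw [pow_succ]; field_simp

/-- Testing with g = 1 on the cube of side ρ(0) centred at 0, the mass of the cube cancels. This
lower bound permits inserting the factor [ω] in part (1), which the John–Nirenberg argument does not
itself produce. -/
lemma one_le_mul_apqConst (hd : 0 < d) (hρ : ∀ x, 0 < ρ x) (hθ : 0 ≤ θ) (hp : 1 ≤ p)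
    (hpq : p < q) (hω : MemApq ρ θ p q ω) :
    1 ≤ ENNReal.ofReal (cubeConst d θ * 2 ^ θ) * apqConst ρ θ p q ω := by
  have hq : 0 < q := by linarith
  have h0 := hρ 0
  have h := mean_mul_powMass_le hd hρ hθ hp hpq hω (g := fun _ => 1) aemeasurable_const 0 h0
  have hQ0 := (volume_cube_pos (0 : EuclideanSpace ℝ (Fin d)) h0).ne'
  have hQt := volume_cube_ne_top (0 : EuclideanSpace ℝ (Fin d)) (ρ 0)
  have hW0 := hω.powMass_ne_zero hρ hp hq hQ0
  have hWt := hω.powMass_cube_ne_top hd hρ hp hq 0 h0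
  have e : ∫⁻ y in cube 0 (ρ 0), (1 : ℝ≥0∞) ^ q * ENNReal.ofReal (ω y) ^ q =
    powMass ω q (cube 0 (ρ 0)) := by simp [powMass]
  rw [e, mean, setLIntegral_const, one_mul, ENNReal.inv_mul_cancel hQ0 hQt, div_self h0.ne',
    one_add_one_eq_two] at h
  set b := powMass ω q (cube 0 (ρ 0)) ^ (1 / q)
  have hb0 : b ≠ 0 := by
    rw [Ne, ENNReal.rpow_eq_zero_iff_of_pos (by positivity)]; exact hW0
  have hbt : b ≠ ∞ := ENNReal.rpow_ne_top_of_nonneg (by positivity) hWt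
  have h2 := (ENNReal.mul_le_mul_iff_left hb0 hbt).1 h
  rw [ENNReal.ofReal_mul (cubeConst_pos hd θ).le]
  exact h2.trans (le_of_eq (by ring))

/-- The weighted John–Nirenberg type estimate on a fixed cube, given a bound `A` for the mean lower
oscillation over all subcubes. -/
lemma weightedLowerOsc_le_of_mean_le (hf : AEMeasurable f volume)
    (hω : AEMeasurable (fun x => ENNReal.ofReal (ω x)) volume)
    (hq : 0 < q) {x₀ : EuclideanSpace ℝ (Fin d)} {r : ℝ} (hr : 0 < r) {A : ℝ} (hA : 0 < A)
    (hsub : ∀ c t, 0 < t → cube c t ⊆ cube x₀ r →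
      mean (cube c t) (lowerOsc f (cube c t)) ≤ ENNReal.ofReal A)
    {δ D : ℝ} (hδ : 0 < δ) (hD : 0 ≤ D)
    (hmass : ∀ S, MeasurableSet S → S ⊆ cube x₀ r → powMass ω q S ≤
      ENNReal.ofReal D * (volume S / volume (cube x₀ r)) ^ δ * powMass ω q (cube x₀ r)) :
    weightedLowerOsc q ω f (cube x₀ r) ≤
      ENNReal.ofReal ((D * ∑' k : ℕ, ((k : ℝ) + 1) ^ q * ((1 / 2 : ℝ) ^ δ) ^ k) ^ (1 / q) *
        (2 ^ (d + 1) * A)) := by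
  obtain ⟨g, hg, hfg⟩ := hf
  set l : ℝ := 2 ^ (d + 1) * A with hl
  have hl0 : 0 < l := by positivity
  have hcubes : ∀ c t, 0 < t → cube c t ⊆ cube x₀ r → ∃ m' : ℝ,
      (∀ᵐ x ∂volume.restrict (cube c t), m' ≤ g x) ∧
      volume {x ∈ cube c t | m' + l ≤ g x} ≤ (2 ^ (d + 1))⁻¹ * volume (cube c t) ∧
      ∀ x, lowerOsc f (cube c t) x = ENNReal.ofReal (f x - m') := by
    intro c t ht hc
    have hQ0 := (volume_cube_pos c ht).ne'
    have hQt := volume_cube_ne_top c t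
    obtain ⟨m', h1, h2⟩ := exists_real_essInf hQ0 hQt
      ((hsub c t ht hc).trans_lt ENNReal.ofReal_lt_top).ne
    have hfg' : ∀ᵐ x ∂volume.restrict (cube c t), f x = g x := ae_restrict_of_ae hfg
    refine ⟨m', ?_, ?_, h2⟩
    · filter_upwards [h1, hfg'] with x hx hx'
      rwa [← hx']
    · have h3 := mul_meas_ge_le_lintegral (μ := volume.restrict (cube c t))
        (f := fun x => ENNReal.ofReal (g x - m')) (by fun_prop) (ENNReal.ofReal l)
      have h4 : {x ∈ cube c t | m' + l ≤ g x} =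
          {x | ENNReal.ofReal l ≤ ENNReal.ofReal (g x - m')} ∩ cube c t := by
        ext x
        simp only [mem_inter_iff, mem_ofPred_eq, and_comm (a := x ∈ cube c t)]
        refine and_congr_left fun _ => ?_
        rw [ENNReal.ofReal_le_ofReal_iff']
        constructor
        · intro h; left; linarith
        · rintro (h | h) <;> linarith
      rw [Measure.restrict_apply (measurableSet_le measurable_const (by fun_prop)), ← h4] at h3
      have h5 : ∫⁻ x in cube c t, ENNReal.ofReal (g x - m') =
          volume (cube c t) * mean (cube c t) (lowerOsc f (cube c t)) := by
        rw [← lintegral_eq_volume_mul_mean hQ0 hQt]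
        refine lintegral_congr_ae ?_
        filter_upwards [hfg'] with x hx
        rw [h2, hx]
      rw [h5] at h3
      have h6 := h3.trans (mul_le_mul_right (hsub c t ht hc) _)
      have hA0 : ENNReal.ofReal A ≠ 0 := (ENNReal.ofReal_pos.2 hA).ne'
      rw [hl, ENNReal.ofReal_mul (by positivity), mul_comm (ENNReal.ofReal (2 ^ (d + 1))),
        mul_comm (volume (cube c t)), mul_assoc,
        ENNReal.mul_le_mul_iff_right hA0 ENNReal.ofReal_ne_top, ENNReal.ofReal_pow (by norm_num),
        ENNReal.ofReal_ofNat] at h6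
      calc _ = (2 ^ (d + 1))⁻¹ * ((2 : ℝ≥0∞) ^ (d + 1) *
            volume {x ∈ cube c t | m' + 2 ^ (d + 1) * A ≤ g x}) := by
            rw [← mul_assoc, ENNReal.inv_mul_cancel (by simp) (by simp), one_mul]
        _ ≤ _ := by gcongr
  obtain ⟨m, hm1, hm2, hm3⟩ := hcubes x₀ r hr subset_rfl
  have hlev := volume_superlevel_le hg hr hl0.le
    (fun c t ht hc => (hcubes c t ht hc).imp fun m' h => ⟨h.1, h.2.1⟩) hm2
  set Q := cube x₀ r with hQ
  have hQm : MeasurableSet Q := measurableSet_cube x₀ r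
  have hQ0 := (volume_cube_pos x₀ hr).ne'
  have hQt := volume_cube_ne_top x₀ r
  rw [← hQ] at hQ0 hQt
  set w : EuclideanSpace ℝ (Fin d) → ℝ≥0∞ := fun x => ENNReal.ofReal (ω x) ^ q with hw
  have hwm : AEMeasurable w volume := hω.pow_const q
  set W := powMass ω q Q with hW
  set T := ∑' k : ℕ, ((k : ℝ) + 1) ^ q * ((1 / 2 : ℝ) ^ δ) ^ k with hT
  have hT0 : 0 ≤ T := tsum_nonneg fun k => by positivity
  have hmain : ∫⁻ x in Q, lowerOsc f Q x ^ q * w x ≤ ENNReal.ofReal (D * T * l ^ q) * W := by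
    calc ∫⁻ x in Q, lowerOsc f Q x ^ q * w x
        = ∫⁻ x in Q, ENNReal.ofReal (g x - m) ^ q * w x := by
          refine lintegral_congr_ae ?_
          filter_upwards [ae_restrict_of_ae hfg] with x hx
          rw [hm3, hx]
      _ = ∫⁻ x, ENNReal.ofReal (g x - m) ^ q ∂(volume.withDensity w).restrict Q := by
          rw [restrict_withDensity hQm, lintegral_withDensity_eq_lintegral_mul₀ hwm.restrict
            (by fun_prop)]
          simp only [Pi.mul_apply, mul_comm (w _)]
      _ ≤ ∑' k : ℕ, ENNReal.ofReal (((k + 1) * l) ^ q) *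
            (volume.withDensity w).restrict Q {x | k * l ≤ g x - m} :=
          lintegral_ofReal_rpow_le_tsum _ (by fun_prop) hl0 hq
      _ ≤ ∑' k : ℕ, ENNReal.ofReal (D * l ^ q) * W *
            ENNReal.ofReal (((k : ℝ) + 1) ^ q * ((1 / 2 : ℝ) ^ δ) ^ k) := by
          refine ENNReal.tsum_le_tsum fun k => ?_
          have hset : {x | k * l ≤ g x - m} ∩ Q = {x ∈ Q | m + k * l ≤ g x} := by
            ext x
            simp only [mem_inter_iff, mem_ofPred_eq, and_comm (a := x ∈ Q)]
            exact and_congr_left fun _ => ⟨fun h => by linarith, fun h => by linarith⟩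
          have hmk : MeasurableSet {x ∈ Q | m + k * l ≤ g x} :=
            hQm.inter (measurableSet_le measurable_const hg)
          rw [Measure.restrict_apply' hQm, hset, ← powMass_eq_withDensity ω q hmk]
          have h1 : (volume {x ∈ Q | m + k * l ≤ g x} / volume Q) ^ δ ≤
              ENNReal.ofReal (((1 / 2 : ℝ) ^ δ) ^ k) := by
            have h2 : volume {x ∈ Q | m + k * l ≤ g x} / volume Q ≤
                ENNReal.ofReal ((1 / 2 : ℝ) ^ k) := by
              rw [ENNReal.div_le_iff hQ0 hQt, one_div, ENNReal.ofReal_pow (by norm_num),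
                ENNReal.ofReal_inv_of_pos (by norm_num), ENNReal.ofReal_ofNat]
              exact hlev k
            refine (ENNReal.rpow_le_rpow h2 hδ.le).trans (le_of_eq ?_)
            rw [ENNReal.ofReal_rpow_of_pos (by positivity), ← Real.rpow_natCast,
              ← Real.rpow_natCast, ← Real.rpow_mul (by norm_num), ← Real.rpow_mul (by norm_num),
              mul_comm δ]
          calc _ ≤ ENNReal.ofReal (((k + 1) * l) ^ q) *
                (ENNReal.ofReal D * ENNReal.ofReal (((1 / 2 : ℝ) ^ δ) ^ k) * W) := by
                gcongr
                exact (hmass _ hmk (sep_subset _ _)).trans (by gcongr)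
            _ = _ := by
                rw [Real.mul_rpow (by positivity) hl0.le, ENNReal.ofReal_mul (by positivity),
                  ENNReal.ofReal_mul hD, ENNReal.ofReal_mul (by positivity)]
                ring
      _ = _ := by
          rw [ENNReal.tsum_mul_left, ← ENNReal.ofReal_tsum_of_nonneg (fun k => by positivity)
            (summable_rpow_mul_rpow q hδ), ← hT, mul_right_comm,
            ← ENNReal.ofReal_mul (by positivity)]
          ring_nf
  rw [weightedLowerOsc]
  calc _ ≤ (W⁻¹ * (ENNReal.ofReal (D * T * l ^ q) * W)) ^ (1 / q) := by
        gcongr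
    _ ≤ (ENNReal.ofReal (D * T * l ^ q)) ^ (1 / q) := by
        refine ENNReal.rpow_le_rpow ?_ (by positivity)
        calc _ = ENNReal.ofReal (D * T * l ^ q) * (W⁻¹ * W) := by ring
          _ ≤ ENNReal.ofReal (D * T * l ^ q) * 1 := by
              gcongr
              exact ENNReal.inv_mul_le_one _
          _ = _ := mul_one _
    _ = _ := by
        rw [ENNReal.ofReal_rpow_of_nonneg (by positivity) (by positivity),
          Real.mul_rpow (by positivity) (by positivity), ← Real.rpow_mul hl0.le,
          mul_one_div_cancel hq.ne', Real.rpow_one]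

/-- Functions in `BLO_{ρ,θ₁}` have weighted lower oscillation in `L^q(ω^q)`. -/
theorem exists_weightedLowerOsc_le (hd : 0 < d) (hρ : ∀ x, 0 < ρ x) (hsv : SlowVariation ρ C₀ N₀)
    (hθ : 0 ≤ θ) (hp : 1 ≤ p) (hpq : p < q) {δ η K : ℝ} (hδ : 0 < δ) (hK : 0 < K)
    {θ₁ : ℝ} (hθ₁ : 0 < θ₁) :
    ∃ C : ℝ, 0 < C ∧ ∀ ω : EuclideanSpace ℝ (Fin d) → ℝ, MemApq ρ θ p q ω →
      MassComparison ρ δ η K ω q → ∀ f : EuclideanSpace ℝ (Fin d) → ℝ, MemBLO ρ θ₁ f →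
      ∀ (x₀ : EuclideanSpace ℝ (Fin d)) (r : ℝ), 0 < r →
        weightedLowerOsc q ω f (cube x₀ r) ≤ ENNReal.ofReal C * apqConst ρ θ p q ω *
          ENNReal.ofReal ((1 + r / ρ x₀) ^ ((N₀ + 1) * θ₁ + η / q)) * bloConst ρ θ₁ f := by
  have hq : 0 < q := by linarith
  have hcd := cubeConst_pos hd θ
  set C₁ := C₀ * (d : ℝ) ^ N₀ with hC₁
  have hC1 : 1 ≤ C₁ := hsv.one_le_const hd
  set T := ∑' k : ℕ, ((k : ℝ) + 1) ^ q * ((1 / 2 : ℝ) ^ δ) ^ k with hT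
  have hT0 : 0 < T := (summable_rpow_mul_rpow q hδ).tsum_pos (fun k => by positivity) 0
    (by positivity)
  set C₂ := (K * T) ^ (1 / q) * (2 ^ (d + 1) * C₁ ^ θ₁) with hC₂
  have hC20 : 0 < C₂ := by positivity
  refine ⟨cubeConst d θ * 2 ^ θ * C₂, by positivity, ?_⟩
  intro ω hω hmass f hf x₀ r hr
  have h0 := hρ x₀
  set L := 1 + r / ρ x₀ with hL
  have hL1 : 1 ≤ L := by linarith [div_pos hr h0]
  have hL0 : 0 < L := by linarith
  set P := L ^ ((N₀ + 1) * θ₁ + η / q) with hP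
  have hP0 : 0 < P := by positivity
  have hb : bloConst ρ θ₁ f ≠ ∞ := hf.2.ne
  have hstep : ∀ b : ℝ, 0 < b → bloConst ρ θ₁ f ≤ ENNReal.ofReal b →
      weightedLowerOsc q ω f (cube x₀ r) ≤ ENNReal.ofReal (C₂ * P * b) := by
    intro b hb0 hfb
    have hN := hsv.2.1
    -- The bound A collects the worst factor (1 + t/ρ(c))^{θ₁} over subcubes; D = K L^η comes from
    -- the mass comparison and gives L^{η/q} after the q-th root.
    refine (weightedLowerOsc_le_of_mean_le (A := C₁ ^ θ₁ * L ^ ((N₀ + 1) * θ₁) * b) (δ := δ)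
      (D := K * L ^ η) hf.1.aestronglyMeasurable.aemeasurable hω.aemeasurable hq hr (by positivity)
      ?_ hδ (by positivity) ?_).trans (le_of_eq ?_)
    · intro c t ht hc
      refine (mean_lowerOsc_le_bloConst hρ θ₁ f c ht).trans ?_
      rw [ENNReal.ofReal_mul (by positivity)]
      refine mul_le_mul' (ENNReal.ofReal_le_ofReal ?_) hfb
      have h1 := hsv.one_add_div_le hρ hd hr (side_le_of_cube_subset hd hr hc)
        (hc (mem_cube_self c ht))
      have hc0 := hρ c
      calc (1 + t / ρ c) ^ θ₁ ≤ (C₁ * L ^ (N₀ + 1)) ^ θ₁ :=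
            Real.rpow_le_rpow (by positivity) h1 hθ₁.le
        _ = _ := by rw [Real.mul_rpow (by positivity) (by positivity), ← Real.rpow_mul hL0.le]
    · intro S hS hSQ
      refine (hmass x₀ r hr S hS hSQ).trans (le_of_eq ?_)
      rw [ENNReal.ofReal_mul hK.le]; ring
    · congr 1
      rw [hC₂, hP, mul_right_comm K, Real.mul_rpow (by positivity) (by positivity),
        ← Real.rpow_mul hL0.le, mul_one_div, Real.rpow_add hL0]
      ring
  have hfin : weightedLowerOsc q ω f (cube x₀ r) ≤
      ENNReal.ofReal (C₂ * P) * bloConst ρ θ₁ f := by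
    -- The norm of f may be 0, while `hstep` needs a positive bound b; a small multiple of ε is
    -- added and then removed.
    refine ENNReal.le_of_forall_pos_le_add fun ε hε _ => ?_
    have hε' : (0 : ℝ) < ε := hε
    set b := (bloConst ρ θ₁ f).toReal with hbdef
    have hb0 : 0 ≤ b := ENNReal.toReal_nonneg
    refine (hstep (b + ε / (C₂ * P)) (by positivity) ?_).trans (le_of_eq ?_)
    · calc bloConst ρ θ₁ f = ENNReal.ofReal b := (ENNReal.ofReal_toReal hb).symm
        _ ≤ _ := ENNReal.ofReal_le_ofReal (by linarith [div_pos hε' (mul_pos hC20 hP0)])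
    · rw [mul_add, mul_div_cancel₀ _ (by positivity), ENNReal.ofReal_add (by positivity) hε'.le,
        ENNReal.ofReal_mul (by positivity), ENNReal.ofReal_toReal hb, ENNReal.ofReal_coe_nnreal]
  calc _ ≤ 1 * (ENNReal.ofReal (C₂ * P) * bloConst ρ θ₁ f) := by rwa [one_mul]
    _ ≤ (ENNReal.ofReal (cubeConst d θ * 2 ^ θ) * apqConst ρ θ p q ω) *
        (ENNReal.ofReal (C₂ * P) * bloConst ρ θ₁ f) := by
        gcongr
        exact one_le_mul_apqConst hd hρ hθ hp hpq hω
    _ = _ := by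
        rw [ENNReal.ofReal_mul hC20.le, ENNReal.ofReal_mul (p := cubeConst d θ * 2 ^ θ)
          (by positivity)]
        ring

/-- A bound for the weighted lower oscillations characterizes `BLO_{ρ,θ₁}`. -/
theorem exists_bloConst_le (hd : 0 < d) (hρ : ∀ x, 0 < ρ x)
    (hθ : 0 ≤ θ) (hp : 1 ≤ p) (hpq : p < q) (M : ℝ≥0) :
    ∃ c : ℝ, 0 < c ∧ ∀ ω : EuclideanSpace ℝ (Fin d) → ℝ, MemApq ρ θ p q ω →
      apqConst ρ θ p q ω ≤ (M : ℝ≥0∞) →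
      ∀ f : EuclideanSpace ℝ (Fin d) → ℝ, AEMeasurable f volume →
      ∀ θ₁ C : ℝ, 0 < θ₁ → 0 < C →
        (∀ (x₀ : EuclideanSpace ℝ (Fin d)) (r : ℝ), 0 < r →
          weightedLowerOsc q ω f (cube x₀ r) ≤ ENNReal.ofReal C * apqConst ρ θ p q ω *
            ENNReal.ofReal ((1 + r / ρ x₀) ^ (θ₁ - θ))) →
        MemBLO ρ θ₁ f ∧ bloConst ρ θ₁ f ≤ ENNReal.ofReal (c * C) * apqConst ρ θ p q ω := by
  have hq : 0 < q := by linarith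
  have hcd := cubeConst_pos hd θ
  refine ⟨cubeConst d θ * (M + 1), by positivity, ?_⟩
  intro ω hω hM f hf θ₁ C hθ₁ hC hyp
  set A := apqConst ρ θ p q ω with hA
  have hAt : A ≠ ∞ := hω.2.2.2.ne
  have hmean : ∀ (x : EuclideanSpace ℝ (Fin d)) (r : ℝ), 0 < r →
      mean (cube x r) (lowerOsc f (cube x r)) ≤
        ENNReal.ofReal (cubeConst d θ * (M + 1) * C) * A * ENNReal.ofReal ((1 + r / ρ x) ^ θ₁) := by
    intro x r hr
    have h0 := hρ x
    have hL0 : 0 < 1 + r / ρ x := by positivity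
    have h := mean_mul_powMass_le hd hρ hθ hp hpq hω (aemeasurable_lowerOsc hf (cube x r)) x hr
    have hW0 := hω.powMass_ne_zero hρ hp hq (volume_cube_pos x hr).ne'
    have hWt := hω.powMass_cube_ne_top hd hρ hp hq x hr
    have h2 := hyp x r hr
    rw [weightedLowerOsc, ENNReal.mul_rpow_of_nonneg _ _ (by positivity), ENNReal.inv_rpow] at h2
    set b := powMass ω q (cube x r) ^ (1 / q)
    have hb0 : b ≠ 0 := by
      rw [Ne, ENNReal.rpow_eq_zero_iff_of_pos (by positivity)]; exact hW0
    have hbt : b ≠ ∞ := ENNReal.rpow_ne_top_of_nonneg (by positivity) hWt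
    set Y := (∫⁻ y in cube x r, lowerOsc f (cube x r) y ^ q * ENNReal.ofReal (ω y) ^ q) ^ (1 / q)
    have h3 : ENNReal.ofReal ((1 + r / ρ x) ^ θ) * ENNReal.ofReal ((1 + r / ρ x) ^ (θ₁ - θ)) =
        ENNReal.ofReal ((1 + r / ρ x) ^ θ₁) := by
      rw [← ENNReal.ofReal_mul (by positivity), ← Real.rpow_add hL0, add_sub_cancel]
    -- The argument produces [ω]²; this bound absorbs one factor into the constant.
    have h4 : A ≤ ENNReal.ofReal (M + 1) := by
      refine hM.trans ?_
      rw [← ENNReal.ofReal_coe_nnreal]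
      exact ENNReal.ofReal_le_ofReal (by linarith)
    calc mean (cube x r) (lowerOsc f (cube x r))
        = mean (cube x r) (lowerOsc f (cube x r)) * b * b⁻¹ := by
          rw [mul_assoc, ENNReal.mul_inv_cancel hb0 hbt, mul_one]
      _ ≤ ENNReal.ofReal (cubeConst d θ) * A * ENNReal.ofReal ((1 + r / ρ x) ^ θ) * Y * b⁻¹ := by
          gcongr
      _ = ENNReal.ofReal (cubeConst d θ) * A * ENNReal.ofReal ((1 + r / ρ x) ^ θ) * (b⁻¹ * Y) := by
          ring
      _ ≤ ENNReal.ofReal (cubeConst d θ) * A * ENNReal.ofReal ((1 + r / ρ x) ^ θ) *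
          (ENNReal.ofReal C * A * ENNReal.ofReal ((1 + r / ρ x) ^ (θ₁ - θ))) := by gcongr
      _ = ENNReal.ofReal (cubeConst d θ) * A * ENNReal.ofReal C * A *
          (ENNReal.ofReal ((1 + r / ρ x) ^ θ) * ENNReal.ofReal ((1 + r / ρ x) ^ (θ₁ - θ))) := by
          ring
      _ ≤ ENNReal.ofReal (cubeConst d θ) * ENNReal.ofReal (M + 1) * ENNReal.ofReal C * A *
          ENNReal.ofReal ((1 + r / ρ x) ^ θ₁) := by rw [h3]; gcongr
      _ = _ := by
          rw [ENNReal.ofReal_mul (by positivity), ENNReal.ofReal_mul hcd.le]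
  have hblo : bloConst ρ θ₁ f ≤ ENNReal.ofReal (cubeConst d θ * (M + 1) * C) * A := by
    refine iSup_le fun x => iSup_le fun r => iSup_le fun hr => ?_
    have h0 := hρ x
    have hL0 : 0 < 1 + r / ρ x := by positivity
    have h1 : ENNReal.ofReal ((1 + r / ρ x) ^ (-θ₁)) * ENNReal.ofReal ((1 + r / ρ x) ^ θ₁) = 1 := by
      rw [← ENNReal.ofReal_mul (by positivity), ← Real.rpow_add hL0]; simp
    calc _ ≤ ENNReal.ofReal ((1 + r / ρ x) ^ (-θ₁)) * (ENNReal.ofReal (cubeConst d θ * (M + 1) * C) *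
          A * ENNReal.ofReal ((1 + r / ρ x) ^ θ₁)) := by
          gcongr
          exact hmean x r hr
      _ = ENNReal.ofReal (cubeConst d θ * (M + 1) * C) * A * (ENNReal.ofReal ((1 + r / ρ x) ^ (-θ₁))
          * ENNReal.ofReal ((1 + r / ρ x) ^ θ₁)) := by ring
      _ = _ := by rw [h1, mul_one]
  refine ⟨⟨?_, hblo.trans_lt (ENNReal.mul_lt_top ENNReal.ofReal_lt_top hAt.lt_top)⟩, hblo⟩
  -- Local integrability: on a unit cube f - m, with m the real essential infimum, is almost
  -- everywhere nonnegative and has finite integral.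
  intro x
  refine ⟨cube x 1, (isOpen_cube x 1).mem_nhds (mem_cube_self x one_pos), ?_⟩
  have hQ0 := (volume_cube_pos x one_pos).ne'
  have hQt := volume_cube_ne_top x 1
  have hfin : mean (cube x 1) (lowerOsc f (cube x 1)) ≠ ∞ :=
    ((hmean x 1 one_pos).trans_lt (ENNReal.mul_lt_top (ENNReal.mul_lt_top ENNReal.ofReal_lt_top
      hAt.lt_top) ENNReal.ofReal_lt_top)).ne
  obtain ⟨m, h1, h2⟩ := exists_real_essInf hQ0 hQt hfin
  have hint : IntegrableOn (fun y => f y - m) (cube x 1) := by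
    refine ⟨(hf.sub_const m).aestronglyMeasurable.restrict, ?_⟩
    rw [hasFiniteIntegral_iff_ofReal (by filter_upwards [h1] with y hy; simpa using hy)]
    simp only [← h2]
    rw [lintegral_eq_volume_mul_mean hQ0 hQt]
    exact ENNReal.mul_lt_top hQt.lt_top hfin.lt_top
  refine (hint.add (integrableOn_const (C := m) hQt)).congr (Eventually.of_forall fun y => ?_)
  simp

end

/-! ### Slow variation of a critical radius from polynomial growth bounds. -/

section

variable {d : ℕ}

lemma le_rpow_mul_of_tripling {g : ℝ → ℝ} (hg0 : ∀ r, 0 < r → 0 ≤ g r)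
    (hmono : ∀ r s, 0 < r → r ≤ s → g r ≤ g s) {D : ℝ} (hD : 1 ≤ D)
    (h3 : ∀ r, 0 < r → g (3 * r) ≤ D * g r) {k r : ℝ} (hk : 1 ≤ k) (hr : 0 < r) :
    g (k * r) ≤ D * k ^ Real.logb 3 D * g r := by
  obtain ⟨n, hn1, hn2⟩ := exists_nat_pow_near hk (by norm_num : (1 : ℝ) < 3)
  have hiter : ∀ n : ℕ, g (3 ^ n * r) ≤ D ^ n * g r := by
    intro n
    induction n with
    | zero => simp
    | succ n ih =>
      rw [pow_succ', mul_assoc, pow_succ', mul_assoc]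
      exact (h3 _ (by positivity)).trans (by gcongr)
  have hlog : 0 ≤ Real.logb 3 D := Real.logb_nonneg (by norm_num) hD
  have hDn : D ^ n ≤ k ^ Real.logb 3 D := by
    calc D ^ n = ((3 : ℝ) ^ Real.logb 3 D) ^ n := by
          rw [Real.rpow_logb (by norm_num) (by norm_num) (by linarith)]
      _ = ((3 : ℝ) ^ n) ^ Real.logb 3 D := by
          rw [← Real.rpow_natCast, ← Real.rpow_natCast, ← Real.rpow_mul (by norm_num),
            ← Real.rpow_mul (by norm_num), mul_comm]
      _ ≤ _ := by gcongr
  calc g (k * r) ≤ g (3 ^ (n + 1) * r) := hmono _ _ (by positivity) (by gcongr)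
    _ ≤ D ^ (n + 1) * g r := hiter _
    _ = D * D ^ n * g r := by rw [pow_succ']
    _ ≤ _ := by have := hg0 r hr; gcongr

/-- Iterates the reverse doubling factor D over the scales 3^n ≤ k < 3^{n+1}; the one extra factor D
pays for rounding k. -/
lemma rpow_mul_le_of_tripling {g : ℝ → ℝ} (hg0 : ∀ r, 0 < r → 0 ≤ g r)
    (hmono : ∀ r s, 0 < r → r ≤ s → g r ≤ g s) {D : ℝ} (hD : 1 ≤ D)
    (h3 : ∀ r, 0 < r → D * g r ≤ g (3 * r)) {k r : ℝ} (hk : 1 ≤ k) (hr : 0 < r) :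
    k ^ Real.logb 3 D * g r ≤ D * g (k * r) := by
  obtain ⟨n, hn1, hn2⟩ := exists_nat_pow_near hk (by norm_num : (1 : ℝ) < 3)
  have hiter : ∀ n : ℕ, D ^ n * g r ≤ g (3 ^ n * r) := by
    intro n
    induction n with
    | zero => simp
    | succ n ih =>
      rw [pow_succ', mul_assoc, pow_succ', mul_assoc]
      exact le_trans (by gcongr) (h3 _ (by positivity))
  have hlog : 0 ≤ Real.logb 3 D := Real.logb_nonneg (by norm_num) hD
  have hDn : k ^ Real.logb 3 D ≤ D ^ (n + 1) := by
    calc k ^ Real.logb 3 D ≤ ((3 : ℝ) ^ (n + 1)) ^ Real.logb 3 D := by gcongr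
      _ = ((3 : ℝ) ^ Real.logb 3 D) ^ (n + 1) := by
          rw [← Real.rpow_natCast, ← Real.rpow_natCast, ← Real.rpow_mul (by norm_num),
            ← Real.rpow_mul (by norm_num), mul_comm]
      _ = D ^ (n + 1) := by
          rw [Real.rpow_logb (by norm_num) (by norm_num) (by linarith)]
  calc k ^ Real.logb 3 D * g r ≤ D ^ (n + 1) * g r := by have := hg0 r hr; gcongr
    _ = D * (D ^ n * g r) := by rw [pow_succ']; ring
    _ ≤ D * g (3 ^ n * r) := by have := hiter n; gcongr
    _ ≤ D * g (k * r) := by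
        have := hmono (3 ^ n * r) (k * r) (by positivity) (by gcongr)
        gcongr

/-- The critical radius attached to a family of ball functionals `v x r` and an exponent `e`. -/
def critRadius {X : Type*} (v : X → ℝ → ℝ) (e : ℝ) (x : X) : ℝ :=
  sSup {r : ℝ | 0 < r ∧ 1 / r ^ e * v x r ≤ 1}

/-- Monotonicity and polynomial growth bounds for a family of ball functionals `v x r`. -/
structure BallGrowth {X : Type*} [PseudoMetricSpace X] (v : X → ℝ → ℝ) (e A β a : ℝ) : Prop where
  exp_pos : 0 < e
  one_le : 1 ≤ A
  upper_nonneg : 0 ≤ β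
  lower_pos : 0 < a
  pos : ∀ x r, 0 < r → 0 < v x r
  mono : ∀ x y r s, 0 < r → dist x y + r ≤ s → v x r ≤ v y s
  upper : ∀ x r k, 0 < r → 1 ≤ k → v x (k * r) ≤ A * k ^ β * v x r
  lower : ∀ x r t, 0 < r → 0 < t → t ≤ 1 →
    1 / (t * r) ^ e * v x (t * r) ≤ A * t ^ a * (1 / r ^ e * v x r)

namespace BallGrowth

variable {X : Type*} [PseudoMetricSpace X] {v : X → ℝ → ℝ} {e A β a : ℝ}

/-- By `lower`, an admissible r > 1 gives v x 1 ≤ A r^{-a}, which bounds r. Without boundedness the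
real supremum would default to 0. -/
lemma bddAbove (hg : BallGrowth v e A β a) (x : X) : BddAbove {r : ℝ | 0 < r ∧ 1 / r ^ e * v x r ≤ 1} := by
  have hA := hg.one_le
  have ha := hg.lower_pos
  have hv := hg.pos x 1 one_pos
  refine ⟨max 1 ((A / v x 1) ^ (1 / a)), ?_⟩
  rintro r ⟨hr, hr1⟩
  rcases le_or_gt r 1 with h | h
  · exact le_max_of_le_left h
  · apply le_max_of_le_right
    have h1 := hg.lower x r r⁻¹ hr (by positivity) (inv_le_one_of_one_le₀ h.le)
    rw [inv_mul_cancel₀ hr.ne', Real.one_rpow, div_one, one_mul, Real.inv_rpow hr.le] at h1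
    have hra : 0 < r ^ a := by positivity
    have h2 : v x 1 ≤ A * (r ^ a)⁻¹ := h1.trans (mul_le_of_le_one_right (by positivity) hr1)
    have h3 : r ^ a ≤ A / v x 1 := by
      rw [le_div_iff₀ hv]
      rw [← div_eq_mul_inv, le_div_iff₀ hra] at h2
      linarith
    calc r = (r ^ a) ^ (1 / a) := by
          rw [← Real.rpow_mul hr.le, mul_one_div_cancel ha.ne', Real.rpow_one]
      _ ≤ _ := Real.rpow_le_rpow hra.le h3 (by positivity)

lemma mul_le_critRadius (hg : BallGrowth v e A β a) (x : X) {r t : ℝ} (hr : 0 < r) (ht : 0 < t) (ht1 : t ≤ 1)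
    (h : A * t ^ a * (1 / r ^ e * v x r) ≤ 1) : t * r ≤ critRadius v e x :=
  le_csSup (hg.bddAbove x)
    ⟨by positivity, (hg.lower x r t hr ht ht1).trans h⟩

lemma critRadius_pos (hg : BallGrowth v e A β a) (x : X) : 0 < critRadius v e x := by
  have hA := hg.one_le
  have ha := hg.lower_pos
  have hv := hg.pos x 1 one_pos
  set t : ℝ := (1 / (A * v x 1 + 1)) ^ (1 / a) with ht
  have h1 : 0 < A * v x 1 := by positivity
  have ht0 : 0 < t := by positivity
  have hta : t ^ a = 1 / (A * v x 1 + 1) := by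
    rw [ht, ← Real.rpow_mul (by positivity), one_div_mul_cancel ha.ne', Real.rpow_one]
  have ht1 : t ≤ 1 := Real.rpow_le_one (by positivity)
    ((div_le_one (by positivity)).2 (by linarith)) (by positivity)
  have := hg.mul_le_critRadius x one_pos ht0 ht1 (by
    rw [hta, Real.one_rpow, div_one, one_mul, mul_one_div, div_mul_eq_mul_div,
      div_le_one (by positivity)]
    linarith)
  linarith

/-- Attainment of the supremum is not needed: an admissible r in (R/2, R] exists, and passing from r
to R costs at most A 2^β. -/
lemma critRadius_value_le (hg : BallGrowth v e A β a) (x : X) :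
    1 / critRadius v e x ^ e * v x (critRadius v e x) ≤ A * 2 ^ β := by
  have hA := hg.one_le
  have he := hg.exp_pos
  have hβ := hg.upper_nonneg
  have h0 := hg.critRadius_pos x
  set R := critRadius v e x with hR
  have hne : {r : ℝ | 0 < r ∧ 1 / r ^ e * v x r ≤ 1}.Nonempty := by
    by_contra h
    rw [not_nonempty_iff_eq_empty] at h
    rw [hR, critRadius, h, Real.sSup_empty] at h0
    exact lt_irrefl _ h0
  obtain ⟨r, ⟨hr, hr1⟩, hrR⟩ := exists_lt_of_lt_csSup hne
    (show R / 2 < sSup {r : ℝ | 0 < r ∧ 1 / r ^ e * v x r ≤ 1} from by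
      change R / 2 < R; linarith)
  have hrR' : r ≤ R := le_csSup (hg.bddAbove x) ⟨hr, hr1⟩
  have hk : 1 ≤ R / r := (one_le_div hr).2 hrR'
  have hk2 : R / r ≤ 2 := by rw [div_le_iff₀ hr]; linarith
  have h1 := hg.upper x r (R / r) hr hk
  rw [div_mul_cancel₀ _ hr.ne'] at h1
  have hvr := hg.pos x r hr
  calc 1 / R ^ e * v x R ≤ 1 / r ^ e * (A * (R / r) ^ β * v x r) := by
        have := hg.pos x R h0
        gcongr
    _ = A * (R / r) ^ β * (1 / r ^ e * v x r) := by ring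
    _ ≤ A * 2 ^ β * 1 := by gcongr
    _ = _ := mul_one _

/-- Monotonicity and upper growth compare the value at (y, R), R the critical radius of x, with that
at (x, kR), so it is polynomial in k. Shrinking R by the power t of k that brings the value below 1
gives an admissible radius at y. -/
lemma critRadius_lower (hg : BallGrowth v e A β a) (x y : X) :
    1 / (A ^ 3 * 2 ^ β) ^ (1 / a) * (1 + dist x y / critRadius v e x) ^ (-((e + β) / a)) ≤
      critRadius v e y / critRadius v e x := by
  have hA := hg.one_le
  have ha := hg.lower_pos
  have he := hg.exp_pos
  have hβ := hg.upper_nonneg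
  have h0 := hg.critRadius_pos x
  have hval := hg.critRadius_value_le x
  set R := critRadius v e x with hR
  set k := 1 + dist x y / R with hk
  have hk1 : 1 ≤ k := by have : 0 ≤ dist x y / R := by positivity
                         linarith
  have hk0 : 0 < k := by linarith
  have hvx := hg.pos x R h0
  have h1 : v y R ≤ v x (k * R) := by
    apply hg.mono y x R _ h0
    rw [hk, add_mul, div_mul_cancel₀ _ h0.ne', dist_comm]; linarith
  have h2 : 1 / R ^ e * v y R ≤ A ^ 2 * 2 ^ β * k ^ (e + β) := by
    calc 1 / R ^ e * v y R ≤ 1 / R ^ e * (A * k ^ β * v x R) := by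
          gcongr
          exact h1.trans (hg.upper x R k h0 hk1)
      _ = A * k ^ β * (1 / R ^ e * v x R) := by ring
      -- Raising k^β to k^{e+β} makes the final exponent (e + β)/a positive even if β = 0.
      _ ≤ A * k ^ (e + β) * (A * 2 ^ β) := by
          gcongr
          linarith
      _ = _ := by ring
  set c := A ^ 3 * (2 : ℝ) ^ β with hc
  have hc1 : 1 ≤ c := one_le_mul_of_one_le_of_one_le (one_le_pow₀ hA)
    (Real.one_le_rpow (by norm_num) hβ)
  have hc0 : 0 < c := by linarith
  set t := 1 / c ^ (1 / a) * k ^ (-((e + β) / a)) with ht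
  have ht0 : 0 < t := by positivity
  have hta : t ^ a = 1 / c * k ^ (-(e + β)) := by
    rw [ht, Real.mul_rpow (by positivity) (by positivity), Real.div_rpow zero_le_one (by positivity),
      Real.one_rpow, ← Real.rpow_mul hc0.le, one_div_mul_cancel ha.ne', Real.rpow_one,
      ← Real.rpow_mul hk0.le, neg_mul, div_mul_cancel₀ _ ha.ne']
  have ht1 : t ≤ 1 := by
    refine mul_le_one₀ ?_ (by positivity) ?_
    · rw [div_le_one (by positivity)]
      exact Real.one_le_rpow hc1 (by positivity)
    · exact Real.rpow_le_one_of_one_le_of_nonpos hk1 (by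
        have : 0 ≤ (e + β) / a := by positivity
        linarith)
  rw [le_div_iff₀ h0]
  refine hg.mul_le_critRadius y h0 ht0 ht1 ?_
  calc A * t ^ a * (1 / R ^ e * v y R) ≤ A * t ^ a * (A ^ 2 * 2 ^ β * k ^ (e + β)) := by gcongr
    _ = c * (1 / c) * (k ^ (-(e + β)) * k ^ (e + β)) := by rw [hta, hc]; ring
    _ = 1 := by
        rw [mul_one_div_cancel hc0.ne', ← Real.rpow_add hk0, neg_add_cancel, Real.rpow_zero, one_mul]
    _ ≤ 1 := le_rfl

/-- The lower bound with x and y exchanged reads s ≤ c(1 + D/s)^N, where s is the ratio of the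
radii. If D ≤ s, then s ≤ c 2^N; otherwise s^{N+1} ≤ c 2^N (1 + D)^N, whose root has the exponent
N/(N + 1). -/
lemma critRadius_upper (hg : BallGrowth v e A β a) {c N : ℝ} (hc : 1 ≤ c) (hN : 0 < N)
    (h : ∀ x y, 1 / c * (1 + dist x y / critRadius v e x) ^ (-N) ≤
      critRadius v e y / critRadius v e x) (x y : X) :
    critRadius v e y / critRadius v e x ≤
      c * 2 ^ N * (1 + dist x y / critRadius v e x) ^ (N / (N + 1)) := by
  have hx := hg.critRadius_pos x
  have hy := hg.critRadius_pos y
  have h1 := h y x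
  set s := critRadius v e y / critRadius v e x with hs
  have hs0 : 0 < s := by positivity
  set D := dist x y / critRadius v e x with hD
  have hD0 : 0 ≤ D := by positivity
  have e1 : dist y x / critRadius v e y = D / s := by
    rw [hD, hs, dist_comm]; field_simp
  have e2 : critRadius v e x / critRadius v e y = s⁻¹ := by rw [hs, inv_div]
  rw [e1, e2, Real.rpow_neg (by positivity), one_div, ← mul_inv,
    inv_le_inv₀ (by positivity) hs0] at h1
  have hk : 1 ≤ (1 + D) ^ (N / (N + 1)) := Real.one_le_rpow (by linarith) (by positivity)
  have h2N : (1 : ℝ) ≤ 2 ^ N := Real.one_le_rpow (by norm_num) hN.le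
  have hcN : 1 ≤ c * 2 ^ N := one_le_mul_of_one_le_of_one_le hc h2N
  rcases le_or_gt D s with hDs | hDs
  · have h3 : D / s ≤ 1 := (div_le_one hs0).2 hDs
    calc s ≤ c * (1 + D / s) ^ N := h1
      _ ≤ c * 2 ^ N * 1 := by
          rw [mul_one]
          gcongr
          linarith
      _ ≤ _ := by gcongr
  · have h3 : 1 ≤ D / s := (one_le_div hs0).2 hDs.le
    have h4 : s ≤ c * 2 ^ N * ((1 + D) ^ N / s ^ N) := by
      calc s ≤ c * (1 + D / s) ^ N := h1
        _ ≤ c * (2 * ((1 + D) / s)) ^ N := by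
            have : D / s ≤ (1 + D) / s := by gcongr; linarith
            gcongr
            linarith
        _ = _ := by
            rw [Real.mul_rpow (by norm_num) (by positivity), Real.div_rpow (by positivity) hs0.le,
              mul_assoc]
    have hsN : 0 < s ^ N := by positivity
    have h5 : s ^ (N + 1) ≤ c * 2 ^ N * (1 + D) ^ N := by
      rw [Real.rpow_add_one hs0.ne']
      calc s ^ N * s ≤ s ^ N * (c * 2 ^ N * ((1 + D) ^ N / s ^ N)) := by gcongr
        _ = _ := by field_simp
    calc s = (s ^ (N + 1)) ^ (1 / (N + 1)) := by
          rw [← Real.rpow_mul hs0.le, mul_one_div_cancel (by positivity), Real.rpow_one]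
      _ ≤ (c * 2 ^ N * (1 + D) ^ N) ^ (1 / (N + 1)) := by gcongr
      _ = (c * 2 ^ N) ^ (1 / (N + 1)) * (1 + D) ^ (N / (N + 1)) := by
          rw [Real.mul_rpow (by positivity) (by positivity), ← Real.rpow_mul (by positivity),
            mul_one_div]
      _ ≤ (c * 2 ^ N) ^ (1 : ℝ) * (1 + D) ^ (N / (N + 1)) := by
          gcongr
          rw [div_le_one (by positivity)]; linarith
      _ = _ := by rw [Real.rpow_one]

/-- Slow variation of the critical radius, from polynomial upper and lower growth bounds. -/
theorem exists_slowVariation (hg : BallGrowth v e A β a) :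
    ∃ C N : ℝ, 1 ≤ C ∧ 0 < N ∧ ∀ x y : X,
      1 / C * (1 + dist x y / critRadius v e x) ^ (-N) ≤ critRadius v e y / critRadius v e x ∧
      critRadius v e y / critRadius v e x ≤
        C * (1 + dist x y / critRadius v e x) ^ (N / (N + 1)) := by
  have hA := hg.one_le
  have ha := hg.lower_pos
  have he := hg.exp_pos
  have hβ := hg.upper_nonneg
  set N := (e + β) / a with hN
  have hN0 : 0 < N := by positivity
  set c := (A ^ 3 * (2 : ℝ) ^ β) ^ (1 / a) with hc
  have hc1 : 1 ≤ c := Real.one_le_rpow (one_le_mul_of_one_le_of_one_le (one_le_pow₀ hA)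
    (Real.one_le_rpow (by norm_num) hβ)) (by positivity)
  have h2N : (1 : ℝ) ≤ 2 ^ N := Real.one_le_rpow (by norm_num) hN0.le
  refine ⟨c * 2 ^ N, N, one_le_mul_of_one_le_of_one_le hc1 h2N, hN0, fun x y => ⟨?_, ?_⟩⟩
  · refine le_trans ?_ (hg.critRadius_lower x y)
    have := hg.critRadius_pos x
    gcongr
    exact le_mul_of_one_le_right (by positivity) h2N
  · exact hg.critRadius_upper hc1 hN0 hg.critRadius_lower x y

end BallGrowth

end

/-! ### Growth of the mass of a reverse Hölder potential. -/

section

/-- Growth bounds for `v` from doubling, when the rescaled `v` is comparable to a power of an additive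
functional `m`. -/
theorem exists_ballGrowth {X : Type*} [PseudoMetricSpace X] {v m : X → ℝ → ℝ} {e σ D C κ : ℝ}
    (he : 0 < e) (hσ : 0 < σ) (hD : 1 ≤ D) (hC : 1 ≤ C) (hκ : 0 < κ)
    (hpos : ∀ x r, 0 < r → 0 < v x r) (hm0 : ∀ x r, 0 ≤ m x r)
    (hvmono : ∀ x y r s, 0 < r → dist x y + r ≤ s → v x r ≤ v y s)
    (hmmono : ∀ x y r s, 0 < r → dist x y + r ≤ s → m x r ≤ m y s)
    (hdoub : ∀ x r, 0 < r → v x (3 * r) ≤ D * v x r)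
    (hlo : ∀ x r, 0 < r → κ * (1 / r ^ e * v x r) ≤ m x r ^ (1 / σ))
    (hhi : ∀ x r, 0 < r → m x r ^ (1 / σ) ≤ C * (κ * (1 / r ^ e * v x r)))
    (hadd : ∀ x r, 0 < r → ∃ y, dist x y = 2 * r ∧ m x r + m y r ≤ m x (3 * r)) :
    ∃ A β a, BallGrowth v e A β a := by
  have hmm : ∀ x r s, 0 < r → r ≤ s → m x r ≤ m x s := fun x r s hr hrs =>
    hmmono x x r s hr (by rw [dist_self]; linarith)
  have hvm : ∀ x r s, 0 < r → r ≤ s → v x r ≤ v x s := fun x r s hr hrs =>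
    hvmono x x r s hr (by rw [dist_self]; linarith)
  have hpow : ∀ x r, (m x r ^ (1 / σ)) ^ σ = m x r := fun x r => by
    rw [← Real.rpow_mul (hm0 x r), one_div_mul_cancel hσ.ne', Real.rpow_one]
  -- Doubling passes from v to m because m^{1/σ} is comparable to the rescaled v.
  have hmdoub : ∀ x r, 0 < r → m x (3 * r) ≤ (C * D) ^ σ * m x r := by
    intro x r hr
    have hv := hpos x r hr
    have h1 : m x (3 * r) ^ (1 / σ) ≤ C * D * m x r ^ (1 / σ) := by
      calc m x (3 * r) ^ (1 / σ) ≤ C * (κ * (1 / (3 * r) ^ e * v x (3 * r))) :=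
            hhi x _ (by positivity)
        _ ≤ C * (κ * (1 / r ^ e * (D * v x r))) := by
            have h0 := (hpos x (3 * r) (by positivity)).le
            have h1 : r ≤ 3 * r := by linarith
            have h2 := hdoub x r hr
            gcongr
        _ = C * D * (κ * (1 / r ^ e * v x r)) := by ring
        _ ≤ _ := by gcongr; exact hlo x r hr
    have h2 := Real.rpow_le_rpow (Real.rpow_nonneg (hm0 _ _) _) h1 hσ.le
    rwa [hpow, Real.mul_rpow (by positivity) (Real.rpow_nonneg (hm0 _ _) _), hpow] at h2
  set D' := (C * D) ^ σ with hD'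
  have hD'0 : 0 < D' := by positivity
  set L := 1 + 1 / D' with hL
  have hL1 : 1 < L := by have : 0 < 1 / D' := by positivity
                         linarith
  -- Reverse doubling: by additivity the ball at x of radius 3r contains, besides the mass m x r,
  -- that of a second ball at y, and doubling at y makes the latter at least m x r / D'.
  have hrev : ∀ x r, 0 < r → L * m x r ≤ m x (3 * r) := by
    intro x r hr
    obtain ⟨y, hy, hxy⟩ := hadd x r hr
    have h1 : m x r ≤ D' * m y r :=
      (hmmono x y r (3 * r) hr (by rw [hy]; linarith)).trans (hmdoub y r hr)
    have h2 : 1 / D' * m x r ≤ m y r := by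
      rw [one_div, inv_mul_le_iff₀ hD'0]; exact h1
    rw [hL, add_mul, one_mul]; linarith
  set α := Real.logb 3 L with hα
  have hα0 : 0 < α := Real.logb_pos (by norm_num) hL1
  refine ⟨max D (C * L ^ (1 / σ)), Real.logb 3 D, α / σ, he, le_max_of_le_left hD,
    Real.logb_nonneg (by norm_num) hD, by positivity, hpos, hvmono, ?_, ?_⟩
  · intro x r k hr hk
    have hv := hpos x r hr
    refine (le_rpow_mul_of_tripling (fun r hr => (hpos x r hr).le) (hvm x) hD (hdoub x)
      hk hr).trans ?_
    gcongr
    exact le_max_left _ _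
  · intro x R t hR ht ht1
    have hv := hpos x R hR
    have h1 := rpow_mul_le_of_tripling (fun r _ => hm0 x r) (hmm x) hL1.le (hrev x)
      ((one_le_div ht).2 ht1) (mul_pos ht hR)
    rw [← mul_assoc, one_div_mul_cancel ht.ne', one_mul, ← hα, Real.div_rpow zero_le_one ht.le,
      Real.one_rpow, one_div, inv_mul_le_iff₀ (by positivity)] at h1
    have h2 : m x (t * R) ^ (1 / σ) ≤ t ^ (α / σ) * L ^ (1 / σ) * m x R ^ (1 / σ) := by
      refine (Real.rpow_le_rpow (hm0 _ _) h1 (by positivity)).trans (le_of_eq ?_)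
      rw [Real.mul_rpow (by positivity) (mul_nonneg (by linarith) (hm0 _ _)),
        Real.mul_rpow (by linarith) (hm0 _ _), ← Real.rpow_mul ht.le, mul_one_div, mul_assoc]
    have h3 : κ * (1 / (t * R) ^ e * v x (t * R)) ≤
        κ * (C * L ^ (1 / σ) * t ^ (α / σ) * (1 / R ^ e * v x R)) := by
      calc _ ≤ m x (t * R) ^ (1 / σ) := hlo x _ (mul_pos ht hR)
        _ ≤ t ^ (α / σ) * L ^ (1 / σ) * m x R ^ (1 / σ) := h2
        _ ≤ t ^ (α / σ) * L ^ (1 / σ) * (C * (κ * (1 / R ^ e * v x R))) := by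
            gcongr
            exact hhi x R hR
        _ = _ := by ring
    refine (le_of_mul_le_mul_left h3 hκ).trans ?_
    gcongr
    exact le_max_right _ _

variable {d : ℕ} {V : EuclideanSpace ℝ (Fin d) → ℝ}

/-- Normalised L^s norms increase with s, so only the endpoint exponent d/2 has to be treated. -/
lemma ReverseHolder.exists_mean_rpow_le (hd : 0 < d) (hV : ∀ x, 0 ≤ V x)
    (hVm : AEStronglyMeasurable V volume) {s : ℝ≥0∞} (hs : (d : ℝ≥0∞) / 2 ≤ s)
    (h : ReverseHolder s V) :
    ∃ C : ℝ, 1 ≤ C ∧ ∀ (x : EuclideanSpace ℝ (Fin d)) (r : ℝ), 0 < r →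
      mean (Metric.ball x r) (fun y => ENNReal.ofReal (V y) ^ ((d : ℝ) / 2)) ^
          (1 / ((d : ℝ) / 2)) ≤
        ENNReal.ofReal C * mean (Metric.ball x r) (fun y => ENNReal.ofReal (V y)) := by
  obtain ⟨C, -, hC⟩ := h
  refine ⟨max 1 C, le_max_left _ _, fun x r hr => ?_⟩
  have : IsProbabilityMeasure ((volume (Metric.ball x r))⁻¹ • volume.restrict (Metric.ball x r)) :=
    isProbabilityMeasure_inv_smul_restrict (volume_ball_ne_zero x hr) (volume_ball_ne_top x r)
  have h1 := eLpNorm_le_eLpNorm_of_exponent_le hs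
    (μ := (volume (Metric.ball x r))⁻¹ • volume.restrict (Metric.ball x r)) (f := V)
    (hVm.restrict.mono_ac Measure.smul_absolutelyContinuous)
  have hd0 : (d : ℝ≥0∞) / 2 ≠ 0 := by
    simp only [ne_eq, ENNReal.div_eq_zero_iff, Nat.cast_eq_zero, ENNReal.ofNat_ne_top, or_false]
    exact hd.ne'
  have hdt : (d : ℝ≥0∞) / 2 ≠ ∞ := ENNReal.div_ne_top (by simp) (by simp)
  rw [eLpNorm_eq_lintegral_rpow_enorm_toReal hd0 hdt] at h1
  simp only [ENNReal.toReal_div, ENNReal.toReal_natCast, ENNReal.toReal_ofNat,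
    Real.enorm_of_nonneg (hV _), ← mean_eq_lintegral_smul] at h1
  refine h1.trans ((hC x r hr).trans ?_)
  gcongr
  exact le_max_right _ _

lemma lintegral_ball_ne_top (hV : LocallyIntegrable V) (x : EuclideanSpace ℝ (Fin d)) (r : ℝ) :
    ∫⁻ y in Metric.ball x r, ENNReal.ofReal (V y) ≠ ∞ :=
  (((hV.integrableOn_isCompact (isCompact_closedBall x r)).mono_set
    Metric.ball_subset_closedBall).lintegral_lt_top).ne

/-- The Hölder estimate for the `V`-mass of a subset of a ball. -/
lemma lintegral_subset_le {σ C : ℝ} (hσ : 1 < σ) (hVm : AEMeasurable V volume)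
    (hrh : ∀ (x : EuclideanSpace ℝ (Fin d)) (r : ℝ), 0 < r →
      mean (Metric.ball x r) (fun y => ENNReal.ofReal (V y) ^ σ) ^ (1 / σ) ≤
        ENNReal.ofReal C * mean (Metric.ball x r) (fun y => ENNReal.ofReal (V y)))
    (x : EuclideanSpace ℝ (Fin d)) {r : ℝ} (hr : 0 < r) {S : Set (EuclideanSpace ℝ (Fin d))}
    (hS : MeasurableSet S) (hSB : S ⊆ Metric.ball x r) :
    ∫⁻ y in S, ENNReal.ofReal (V y) ≤
      ENNReal.ofReal C * ((volume (Metric.ball x r))⁻¹ * volume S) ^ (1 / (σ / (σ - 1))) *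
        ∫⁻ y in Metric.ball x r, ENNReal.ofReal (V y) := by
  set B := Metric.ball x r with hB
  have hB0 : volume B ≠ 0 := volume_ball_ne_zero x hr
  have hBt : volume B ≠ ∞ := volume_ball_ne_top x r
  set μ := (volume B)⁻¹ • volume.restrict B with hμ
  have hac : μ ≪ volume :=
    Measure.smul_absolutelyContinuous.trans Measure.restrict_le_self.absolutelyContinuous
  have hconj : σ.HolderConjugate (σ / (σ - 1)) := Real.HolderConjugate.conjExponent hσ
  have hσ' : 0 < σ / (σ - 1) := hconj.symm.pos
  have h1 := ENNReal.lintegral_mul_le_Lp_mul_Lq μ hconj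
    (f := fun y => ENNReal.ofReal (V y)) (g := S.indicator 1)
    (hVm.ennreal_ofReal.mono_ac hac) (aemeasurable_one.indicator hS)
  simp only [Pi.mul_apply] at h1
  have e1 : ∀ y, ENNReal.ofReal (V y) * S.indicator 1 y =
      S.indicator (fun y => ENNReal.ofReal (V y)) y := by
    intro y; by_cases hy : y ∈ S <;> simp [hy]
  have e2 : ∀ y, (S.indicator 1 y : ℝ≥0∞) ^ (σ / (σ - 1)) = S.indicator 1 y := by
    intro y; by_cases hy : y ∈ S <;> simp [hy, hσ']
  simp only [e1, e2, hμ, ← mean_eq_lintegral_smul] at h1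
  have h2 := h1.trans (mul_le_mul_left (hrh x r hr) _)
  rw [← hB, mean, mean, mean, setLIntegral_indicator hS, inter_eq_left.2 hSB,
    lintegral_indicator_one hS, Measure.restrict_apply hS, inter_eq_left.2 hSB] at h2
  have h3 := mul_le_mul_right h2 (volume B)
  rw [← mul_assoc, ENNReal.mul_inv_cancel hB0 hBt, one_mul] at h3
  refine h3.trans (le_of_eq ?_)
  calc _ = (volume B * (volume B)⁻¹) * (ENNReal.ofReal C *
        ((volume B)⁻¹ * volume S) ^ (1 / (σ / (σ - 1))) * ∫⁻ y in B, ENNReal.ofReal (V y)) := by ring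
    _ = _ := by rw [ENNReal.mul_inv_cancel hB0 hBt, one_mul]

/-- The measure `V dx` is doubling. -/
lemma exists_tripling (hd : 0 < d) {σ C : ℝ} (hσ : 1 < σ) (hC : 1 ≤ C) (hV : LocallyIntegrable V)
    (hrh : ∀ (x : EuclideanSpace ℝ (Fin d)) (r : ℝ), 0 < r →
      mean (Metric.ball x r) (fun y => ENNReal.ofReal (V y) ^ σ) ^ (1 / σ) ≤
        ENNReal.ofReal C * mean (Metric.ball x r) (fun y => ENNReal.ofReal (V y))) :
    ∃ D : ℝ, 1 ≤ D ∧ ∀ (x : EuclideanSpace ℝ (Fin d)) (r : ℝ), 0 < r →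
      (∫⁻ y in Metric.ball x (3 * r), ENNReal.ofReal (V y)).toReal ≤
        D * (∫⁻ y in Metric.ball x r, ENNReal.ofReal (V y)).toReal := by
  have : Nonempty (Fin d) := ⟨⟨0, hd⟩⟩
  have hconj : σ.HolderConjugate (σ / (σ - 1)) := Real.HolderConjugate.conjExponent hσ
  have hσ' : 0 < σ / (σ - 1) := hconj.symm.pos
  set τ := σ / (σ - 1) with hτ
  set ε : ℝ := (1 / (2 * C)) ^ τ with hε
  have hC2 : 1 / (2 * C) < 1 := by rw [div_lt_one (by positivity)]; linarith
  have hε0 : 0 < ε := by positivity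
  have hε1 : ε < 1 := Real.rpow_lt_one (by positivity) hC2 hσ'
  -- The shell between the balls of radii ur and r has density ε in the larger one, and ε is chosen
  -- so that C ε^{1/τ} = 1/2: the shell carries at most half of the mass.
  set u : ℝ := (1 - ε) ^ (1 / (d : ℝ)) with hu
  have hd' : (0 : ℝ) < d := by exact_mod_cast hd
  have hu0 : 0 < u := Real.rpow_pos_of_pos (by linarith) _
  have hu1 : u < 1 := Real.rpow_lt_one (by linarith) (by linarith) (by positivity)
  have hud : u ^ d = 1 - ε := by
    rw [hu, ← Real.rpow_natCast, ← Real.rpow_mul (by linarith), one_div_mul_cancel hd'.ne',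
      Real.rpow_one]
  set W : EuclideanSpace ℝ (Fin d) → ℝ → ℝ≥0∞ :=
    fun x r => ∫⁻ y in Metric.ball x r, ENNReal.ofReal (V y) with hW
  have hWt : ∀ x r, W x r ≠ ∞ := lintegral_ball_ne_top hV
  have hstep : ∀ x r, 0 < r → (W x r).toReal ≤ 2 * (W x (u * r)).toReal := by
    intro x r hr
    set B := Metric.ball x r with hB
    set B' := Metric.ball x (u * r) with hB'
    have hB0 : volume B ≠ 0 := volume_ball_ne_zero x hr
    have hBt : volume B ≠ ∞ := volume_ball_ne_top x r
    have hsub : B' ⊆ B := Metric.ball_subset_ball (by nlinarith)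
    have hSm : MeasurableSet (B \ B') := measurableSet_ball.diff measurableSet_ball
    have h1 := lintegral_subset_le hσ hV.aestronglyMeasurable.aemeasurable hrh x hr hSm
      sdiff_subset
    have h2 : (volume B)⁻¹ * volume (B \ B') = ENNReal.ofReal ε := by
      have hvB' : volume B' = ENNReal.ofReal (1 - ε) * volume B := by
        rw [hB', hB, Measure.addHaar_ball _ _ (by positivity), Measure.addHaar_ball _ _ hr.le,
          finrank_euclideanSpace_fin, mul_pow, hud, ENNReal.ofReal_mul (by linarith), mul_assoc]
      rw [measure_sdiff hsub measurableSet_ball.nullMeasurableSet (volume_ball_ne_top _ _), hvB',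
        ENNReal.mul_sub (fun _ _ => ENNReal.inv_ne_top.2 hB0), ENNReal.inv_mul_cancel hB0 hBt,
        mul_left_comm, ENNReal.inv_mul_cancel hB0 hBt, mul_one, ← ENNReal.ofReal_one,
        ← ENNReal.ofReal_sub _ (by linarith), sub_sub_cancel]
    rw [← hB, h2, ENNReal.ofReal_rpow_of_pos hε0, hε, ← Real.rpow_mul (by positivity),
      mul_one_div_cancel hσ'.ne', Real.rpow_one, ← ENNReal.ofReal_mul (by positivity)] at h1
    have h3 : C * (1 / (2 * C)) = 1 / 2 := by field_simp
    rw [h3] at h1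
    have h4 : W x r ≤ W x (u * r) + ENNReal.ofReal (1 / 2) * W x r := by
      calc W x r = ∫⁻ y in B' ∪ (B \ B'), ENNReal.ofReal (V y) := by
            rw [union_sdiff_cancel hsub]
        _ ≤ W x (u * r) + ∫⁻ y in B \ B', ENNReal.ofReal (V y) := lintegral_union_le _ _ _
        _ ≤ _ := by gcongr
    have h5 := ENNReal.toReal_mono (ENNReal.add_ne_top.2 ⟨hWt x (u * r),
      ENNReal.mul_ne_top ENNReal.ofReal_ne_top (hWt x r)⟩) h4
    rw [ENNReal.toReal_add (hWt _ _) (ENNReal.mul_ne_top ENNReal.ofReal_ne_top (hWt x r)),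
      ENNReal.toReal_mul, ENNReal.toReal_ofReal (by norm_num)] at h5
    linarith
  have hiter : ∀ n : ℕ, ∀ x r, 0 < r → (W x r).toReal ≤ 2 ^ n * (W x (u ^ n * r)).toReal := by
    intro n
    induction n with
    | zero => intro x r _; simp
    | succ n ih =>
      intro x r hr
      refine (ih x r hr).trans ?_
      rw [pow_succ, mul_assoc, pow_succ' u, mul_assoc u]
      have := hstep x (u ^ n * r) (by positivity)
      gcongr
  obtain ⟨n, hn⟩ := exists_pow_lt_of_lt_one (by norm_num : (0 : ℝ) < 1 / 3) hu1
  refine ⟨2 ^ n, one_le_pow₀ (by norm_num), fun x r hr => ?_⟩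
  refine (hiter n x (3 * r) (by positivity)).trans ?_
  have : u ^ n * (3 * r) ≤ r := by nlinarith
  refine mul_le_mul_of_nonneg_left (ENNReal.toReal_mono (hWt x r) ?_) (by positivity)
  exact lintegral_mono_set (Metric.ball_subset_ball this)

/-- Doubling would spread a vanishing mass from one ball to the whole space. -/
lemma toReal_lintegral_ball_pos (hV : ∀ x, 0 ≤ V x) (hVl : LocallyIntegrable V)
    (hV0 : ¬ (V =ᵐ[volume] 0)) {D : ℝ}
    (hD : ∀ (x : EuclideanSpace ℝ (Fin d)) (r : ℝ), 0 < r →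
      (∫⁻ y in Metric.ball x (3 * r), ENNReal.ofReal (V y)).toReal ≤
        D * (∫⁻ y in Metric.ball x r, ENNReal.ofReal (V y)).toReal)
    (x : EuclideanSpace ℝ (Fin d)) {r : ℝ} (hr : 0 < r) :
    0 < (∫⁻ y in Metric.ball x r, ENNReal.ofReal (V y)).toReal := by
  refine lt_of_le_of_ne ENNReal.toReal_nonneg fun h0 => hV0 ?_
  have hn : ∀ n : ℕ, (∫⁻ y in Metric.ball x (3 ^ n * r), ENNReal.ofReal (V y)).toReal = 0 := by
    intro n
    induction n with
    | zero => simpa using h0.symm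
    | succ n ih =>
      have h1 := hD x (3 ^ n * r) (by positivity)
      rw [ih, mul_zero, ← mul_assoc, ← pow_succ'] at h1
      exact le_antisymm h1 ENNReal.toReal_nonneg
  have hae : ∀ n : ℕ, ∀ᵐ y ∂volume.restrict (Metric.ball x (3 ^ n * r)), V y = 0 := by
    intro n
    have h1 := (ENNReal.toReal_eq_zero_iff _).1 (hn n)
    rw [or_iff_left (lintegral_ball_ne_top hVl x _), lintegral_eq_zero_iff'
      hVl.aestronglyMeasurable.aemeasurable.ennreal_ofReal.restrict] at h1
    filter_upwards [h1] with y hy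
    exact le_antisymm (ENNReal.ofReal_eq_zero.1 hy) (hV y)
  have hU : (⋃ n : ℕ, Metric.ball x (3 ^ n * r)) = univ := by
    refine eq_univ_of_forall fun y => mem_iUnion.2 ?_
    obtain ⟨n, hn⟩ := pow_unbounded_of_one_lt (dist y x / r) (by norm_num : (1 : ℝ) < 3)
    exact ⟨n, by rw [Metric.mem_ball]; exact (div_lt_iff₀ hr).1 hn⟩
  have := (ae_restrict_iUnion_iff (fun n : ℕ => Metric.ball x (3 ^ n * r))
    (fun y => V y = 0)).2 hae
  rwa [hU, Measure.restrict_univ] at this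

/-- A potential in `RH_{d/2}` has polynomially growing mass, and `r^{2-d} ∫_{B(x,r)} V` decays like a
power of `r`. -/
theorem exists_ballGrowth_of_reverseHolder (hd : 3 ≤ d) (hV : ∀ x, 0 ≤ V x)
    (hVl : LocallyIntegrable V) (hV0 : ¬ (V =ᵐ[volume] 0)) {s : ℝ≥0∞} (hs : (d : ℝ≥0∞) / 2 ≤ s)
    (h : ReverseHolder s V) :
    ∃ A β a, BallGrowth (fun x r => ∫ y in Metric.ball x r, V y) ((d : ℝ) - 2) A β a := by
  have hd0 : 0 < d := by omega
  have hd3 : (3 : ℝ) ≤ d := by exact_mod_cast hd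
  have : Nonempty (Fin d) := ⟨⟨0, hd0⟩⟩
  obtain ⟨C, hC, hrh⟩ := h.exists_mean_rpow_le hd0 hV hVl.aestronglyMeasurable hs
  set σ : ℝ := (d : ℝ) / 2 with hσ
  have hσ1 : 1 < σ := by rw [hσ]; linarith
  have hσ0 : 0 < σ := by linarith
  obtain ⟨D, hD, htrip⟩ := exists_tripling hd0 hσ1 hC hVl hrh
  have hpos := fun x r hr => toReal_lintegral_ball_pos hV hVl hV0 htrip x (r := r) hr
  have hv : ∀ x r, ∫ y in Metric.ball x r, V y =
      (∫⁻ y in Metric.ball x r, ENNReal.ofReal (V y)).toReal := fun x r =>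
    integral_eq_lintegral_of_nonneg_ae (Eventually.of_forall hV) hVl.aestronglyMeasurable.restrict
  simp only [hv]
  set F : EuclideanSpace ℝ (Fin d) → ℝ≥0∞ := fun y => ENNReal.ofReal (V y) with hF
  have hFm : AEMeasurable F volume := hVl.aestronglyMeasurable.aemeasurable.ennreal_ofReal
  have hWt : ∀ x r, ∫⁻ y in Metric.ball x r, F y ≠ ∞ := lintegral_ball_ne_top hVl
  have hMt : ∀ x r, ∫⁻ y in Metric.ball x r, F y ^ σ ≠ ∞ := by
    intro x r
    rcases le_or_gt r 0 with hr | hr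
    · simp [Metric.ball_eq_empty.2 hr]
    · intro htop
      have h1 := hrh x r hr
      rw [mean, htop, ENNReal.mul_top (ENNReal.inv_ne_zero.2 (volume_ball_ne_top x r)),
        ENNReal.top_rpow_of_pos (by positivity), top_le_iff] at h1
      exact ENNReal.mul_ne_top ENNReal.ofReal_ne_top (ENNReal.mul_ne_top
        (ENNReal.inv_ne_top.2 (volume_ball_ne_zero x hr)) (hWt x r)) h1
  set b := (volume (Metric.ball (0 : EuclideanSpace ℝ (Fin d)) 1)).toReal with hb
  have hb0 : 0 < b := ENNReal.toReal_pos (volume_ball_ne_zero _ one_pos) (volume_ball_ne_top _ _)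
  have hvol : ∀ (x : EuclideanSpace ℝ (Fin d)) r, 0 < r →
      (volume (Metric.ball x r)).toReal = r ^ d * b := by
    intro x r hr
    rw [Measure.addHaar_ball _ _ hr.le, finrank_euclideanSpace_fin, ENNReal.toReal_mul,
      ENNReal.toReal_ofReal (by positivity)]
  set w : EuclideanSpace ℝ (Fin d) → ℝ → ℝ :=
    fun x r => (∫⁻ y in Metric.ball x r, F y).toReal with hw
  set m : EuclideanSpace ℝ (Fin d) → ℝ → ℝ :=
    fun x r => (∫⁻ y in Metric.ball x r, F y ^ σ).toReal with hm
  have hm0 : ∀ x r, 0 ≤ m x r := fun x r => ENNReal.toReal_nonneg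
  -- Since 1/σ = 2/d, the power (r^d)^{1/σ} is r², which turns the averaging factor r^{-d} into
  -- exactly r^{2-d}.
  have hscale : ∀ r : ℝ, 0 < r → ∀ t : ℝ, (r ^ d * b) ^ (1 / σ) * ((r ^ d * b)⁻¹ * t) =
      (b ^ (1 / σ) * b⁻¹) * (1 / r ^ ((d : ℝ) - 2) * t) := by
    intro r hr t
    have h1 : (r ^ d) ^ (1 / σ) = r ^ 2 := by
      rw [← Real.rpow_natCast r d, ← Real.rpow_mul hr.le, hσ, ← Real.rpow_natCast r 2]
      congr 1
      field_simp
      norm_num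
    have h2 : r ^ ((d : ℝ) - 2) = r ^ d / r ^ 2 := by
      rw [Real.rpow_sub hr, Real.rpow_natCast, Real.rpow_ofNat]
    rw [Real.mul_rpow (by positivity) hb0.le, h1, h2]
    field_simp
  have hm' : ∀ x r, 0 < r → m x r ^ (1 / σ) =
      (r ^ d * b) ^ (1 / σ) * ((r ^ d * b)⁻¹ * m x r) ^ (1 / σ) := by
    intro x r hr
    rw [← Real.mul_rpow (by positivity) (mul_nonneg (by positivity) (hm0 x r)), ← mul_assoc,
      mul_inv_cancel₀ (by positivity), one_mul]
  refine exists_ballGrowth (v := w) (m := m) (σ := σ) (D := D) (C := C)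
    (κ := b ^ (1 / σ) * b⁻¹) (by linarith) hσ0 hD hC (by positivity) hpos hm0
    ?_ ?_ htrip ?_ ?_ ?_
  · intro x y r s _ hs
    exact ENNReal.toReal_mono (hWt y s) (lintegral_mono_set
      (Metric.ball_subset_ball' (by linarith)))
  · intro x y r s _ hs
    exact ENNReal.toReal_mono (hMt y s) (lintegral_mono_set
      (Metric.ball_subset_ball' (by linarith)))
  · intro x r hr
    rw [hm' x r hr, ← hscale r hr]
    gcongr
    have : IsProbabilityMeasure
        ((volume (Metric.ball x r))⁻¹ • volume.restrict (Metric.ball x r)) :=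
      isProbabilityMeasure_inv_smul_restrict (volume_ball_ne_zero x hr) (volume_ball_ne_top x r)
    have h1 := lintegral_rpow_rpow_mono (hFm.mono_ac ((Measure.smul_absolutelyContinuous
      (c := (volume (Metric.ball x r))⁻¹)).trans
      (Measure.restrict_le_self (s := Metric.ball x r)).absolutelyContinuous)) one_pos hσ1.le
    simp only [ENNReal.rpow_one, div_one, ← mean_eq_lintegral_smul] at h1
    have h2 := ENNReal.toReal_mono (ENNReal.rpow_ne_top_of_nonneg (by positivity)
      (ENNReal.mul_ne_top (ENNReal.inv_ne_top.2 (volume_ball_ne_zero x hr)) (hMt x r))) h1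
    simp only [mean] at h2
    rwa [← ENNReal.toReal_rpow, ENNReal.toReal_mul, ENNReal.toReal_mul,
      ENNReal.toReal_inv, hvol x r hr] at h2
  · intro x r hr
    rw [hm' x r hr, ← hscale r hr, mul_left_comm]
    gcongr
    have h2 := ENNReal.toReal_mono (ENNReal.mul_ne_top ENNReal.ofReal_ne_top
      (ENNReal.mul_ne_top (ENNReal.inv_ne_top.2 (volume_ball_ne_zero x hr)) (hWt x r))) (hrh x r hr)
    simp only [mean] at h2
    rwa [← ENNReal.toReal_rpow, ENNReal.toReal_mul, ENNReal.toReal_mul,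
      ENNReal.toReal_mul, ENNReal.toReal_inv, hvol x r hr,
      ENNReal.toReal_ofReal (by linarith)] at h2
  · intro x r hr
    -- The balls of radius r at x and at distance 2r from it are disjoint and both lie in the ball
    -- B(x, 3r).
    refine ⟨x + EuclideanSpace.single ⟨0, hd0⟩ (2 * r), ?_, ?_⟩
    · rw [dist_self_add_right, PiLp.norm_single, Real.norm_of_nonneg (by positivity)]
    · set y := x + EuclideanSpace.single (⟨0, hd0⟩ : Fin d) (2 * r) with hy
      have hxy : dist x y = 2 * r := by
        rw [hy, dist_self_add_right, PiLp.norm_single,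
          Real.norm_of_nonneg (by positivity)]
      have hdisj : Disjoint (Metric.ball x r) (Metric.ball y r) :=
        Metric.ball_disjoint_ball (by rw [hxy]; linarith)
      rw [hm]
      dsimp only
      rw [← ENNReal.toReal_add (hMt x r) (hMt y r), ← lintegral_union measurableSet_ball hdisj]
      refine ENNReal.toReal_mono (hMt x _) (lintegral_mono_set (union_subset ?_ ?_))
      · exact Metric.ball_subset_ball (by linarith)
      · exact Metric.ball_subset_ball' (by rw [dist_comm, hxy]; linarith)

end

end Schrodinger

end

end

theorem mainTheorem3 {d : ℕ} (hd : 3 ≤ d) (V : EuclideanSpace ℝ (Fin d) → ℝ)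
    (hV_nonneg : ∀ x, 0 ≤ V x) (hV_loc : LocallyIntegrable V)
    (hV_ne : ¬ (V =ᵐ[volume] 0)) (s : ℝ≥0∞) (hs : (d : ℝ≥0∞) / 2 ≤ s)
    (hV_rh : Schrodinger.ReverseHolder s V) :
    (∃ C₀ N₀ : ℝ, Schrodinger.SlowVariation (Schrodinger.criticalRadius V) C₀ N₀) ∧
    ∀ C₀ N₀ : ℝ, Schrodinger.SlowVariation (Schrodinger.criticalRadius V) C₀ N₀ →
    ∀ p q θ₂ : ℝ, 1 ≤ p → p < q → 0 < θ₂ →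
      -- admissible exponents `η` exist, uniformly for bounded characteristic constants
      (∀ M : ℝ≥0, ∃ δ η K : ℝ, 0 < δ ∧ δ < 1 ∧ 1 < η ∧ 0 < K ∧
        ∀ ω : EuclideanSpace ℝ (Fin d) → ℝ,
          Schrodinger.MemApq (Schrodinger.criticalRadius V) θ₂ p q ω →
          Schrodinger.apqConst (Schrodinger.criticalRadius V) θ₂ p q ω ≤ (M : ℝ≥0∞) →
          Schrodinger.MassComparison (Schrodinger.criticalRadius V) δ η K ω q) ∧
      -- part (1)
      (∀ δ η K : ℝ, 0 < δ → δ < 1 → 1 < η → 0 < K → ∀ θ₁ : ℝ, 0 < θ₁ →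
        ∃ C : ℝ, 0 < C ∧ ∀ ω : EuclideanSpace ℝ (Fin d) → ℝ,
          Schrodinger.MemApq (Schrodinger.criticalRadius V) θ₂ p q ω →
          Schrodinger.MassComparison (Schrodinger.criticalRadius V) δ η K ω q →
          ∀ f : EuclideanSpace ℝ (Fin d) → ℝ,
            Schrodinger.MemBLO (Schrodinger.criticalRadius V) θ₁ f →
            ∀ (x₀ : EuclideanSpace ℝ (Fin d)) (r : ℝ), 0 < r →
              Schrodinger.weightedLowerOsc q ω f (Schrodinger.cube x₀ r) ≤
                ENNReal.ofReal C *
                  Schrodinger.apqConst (Schrodinger.criticalRadius V) θ₂ p q ω *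
                  ENNReal.ofReal ((1 + r / Schrodinger.criticalRadius V x₀) ^
                    ((N₀ + 1) * θ₁ + η / q)) *
                  Schrodinger.bloConst (Schrodinger.criticalRadius V) θ₁ f) ∧
      -- part (2)
      (∀ M : ℝ≥0, ∃ c : ℝ, 0 < c ∧ ∀ ω : EuclideanSpace ℝ (Fin d) → ℝ,
        Schrodinger.MemApq (Schrodinger.criticalRadius V) θ₂ p q ω →
        Schrodinger.apqConst (Schrodinger.criticalRadius V) θ₂ p q ω ≤ (M : ℝ≥0∞) →
        ∀ f : EuclideanSpace ℝ (Fin d) → ℝ, AEMeasurable f volume →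
        ∀ θ₁ C : ℝ, 0 < θ₁ → 0 < C →
          (∀ (x₀ : EuclideanSpace ℝ (Fin d)) (r : ℝ), 0 < r →
            Schrodinger.weightedLowerOsc q ω f (Schrodinger.cube x₀ r) ≤
              ENNReal.ofReal C *
                Schrodinger.apqConst (Schrodinger.criticalRadius V) θ₂ p q ω *
                ENNReal.ofReal ((1 + r / Schrodinger.criticalRadius V x₀) ^ (θ₁ - θ₂))) →
          Schrodinger.MemBLO (Schrodinger.criticalRadius V) θ₁ f ∧
            Schrodinger.bloConst (Schrodinger.criticalRadius V) θ₁ f ≤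
              ENNReal.ofReal (c * C) *
                Schrodinger.apqConst (Schrodinger.criticalRadius V) θ₂ p q ω) := by
  have hd0 : 0 < d := by omega
  obtain ⟨A, β, a, hg⟩ :=
    Schrodinger.exists_ballGrowth_of_reverseHolder hd hV_nonneg hV_loc hV_ne hs hV_rh
  -- `criticalRadius V` is by definition `critRadius` of the functional ∫_{B(x,r)} V with e = d - 2,
  -- so the abstract results apply to it directly.
  have hρ : ∀ x, 0 < Schrodinger.criticalRadius V x := fun x => hg.critRadius_pos x
  refine ⟨hg.exists_slowVariation, fun C₀ N₀ hsv p q θ₂ hp hpq hθ₂ => ⟨fun M => ?_, ?_, fun M => ?_⟩⟩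
  · exact Schrodinger.exists_massComparison hd0 hρ hsv hθ₂.le hp hpq M
  · intro δ η K hδ _ _ hK θ₁ hθ₁
    exact Schrodinger.exists_weightedLowerOsc_le hd0 hρ hsv hθ₂.le hp hpq hδ hK hθ₁
  · exact Schrodinger.exists_bloConst_le hd0 hρ hθ₂.le hp hpq M
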